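/- Let $(M,d)$ be a metric space, let $X\subseteq M$ (clients) and $Y\subseteq M$ (servers) be finite, let $\alpha\ge 1$ be real, and let $\kappa:X\to\mathbb{Z}_{\ge 0}$ be a demand function with $\kappa(x)\le |Y|$ for all $x\in X$. An assignment $r:Y\to\mathbb{R}_{\ge 0}$ is a $\kappa$-cover of $X$ if $|\{y\in Y: d(x,y)\le r(y)\}|\ge\kappa(x)$ for all $x\in X$; its cost is $\sum_{y\in Y} r(y)^{\alpha}$. A $1$-cover of $X'$ by $Y'$ is the case $\kappa\equiv 1$ with clients $X'$ and servers $Y'$. Let $N(x,j)$ be the set of the $j$ nearest servers of $x$, for a fixed ordering of $Y$ by distance from $x$ (ties broken arbitrarily), and put $k=\max_{x\in X}\kappa(x)$, $l=\lceil k/2\rceil$. A client $x_2$ *threatens* $x_1$ if $\kappa(x_2)<\kappa(x_1)$ and $N(x_1,\kappa(x_1)-\lfloor\kappa(x_2)/2\rfloor)\cap N(x_2,\kappa(x_2)-\lfloor\kappa(x_2)/2\rfloor)\neq\varnothing$. For $i\ge1$ let $G^i$ be the graph on $X$ in which distinct $x,x'$ are adjacent if $i\le\lceil\kappa(x)/2\rceil$,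 $i\le\lceil\kappa(x')/2\rceil$ and $N(x,\kappa(x)-(i-1))\cap N(x',\kappa(x')-(i-1))\ne\varnothing$. Let $\mathrm{Cover}(X',Y',\alpha)$ be any procedure that, whenever $X'=\varnothing$ or $Y'\neq\varnothing$, returns in polynomial time a $1$-cover of $X'$ by $Y'$ of cost at most $3^{\alpha}$ times the optimum. The algorithm NonUniformCover does the following. 1. Process the clients by non-increasing demand; keep each unmarked client and mark all clients that threaten it. Let $\overline X$ be the set of kept clients. 2. Build $X^1\subseteq X^2\subseteq\dots\subseteq X^k$, where $X^i$ is obtained from $X^{i-1}$ (with $X^0=\varnothing$) by adding, as long as there is one, an arbitrary client of $\overline X$ at hop distance more than $2$ in $G^i[\overline X]$ from all clients chosen so far. 3. Mark all servers available. For $i=1,\dots,l$ and for every $x\in X^i$: if $\kappa(x)\ge 2i$, move the farthest available server of $N(x,\kappa(x)-(i-1))$ (the last one in the fixed ordering) to $Y_i^s$; then, if $\kappa(x)\ge 2i-1$, move any available server of $N(x,\lceil\kappa(x)/2\rceil)$ to $Y_i^p$. Moved servers become unavailable. 4. Set $r=0$. For $i=1,\dots,l$: if $k$ is even or $i<l$,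 set $r$ on $Y_i^s$ to the result of Cover for the clients $\{x:\kappa(x)\ge 2i\}$ and servers $Y_i^s$; set $r$ on $Y_i^p$ to the result of Cover for the clients $\{x:\kappa(x)\ge 2i-1\}$ and servers $Y_i^p$. Return $r$. **Theorem.** For every such procedure Cover there is a polynomial $p$, independent of the input, such that for all $(M,d),X,Y,\kappa,\alpha$ as above and for every way of making the arbitrary choices, NonUniformCover halts after at most $p(|X|+|Y|)$ elementary steps (on a random access machine with unit-cost exact operations on reals, including $x\mapsto x^{\alpha}$) and returns a $\kappa$-cover of $X$ of cost at most $2\cdot 144^{\alpha}$ times the cost of an optimal $\kappa$-cover. Moreover the sets $Y_i^s$, $Y_i^p$ are pairwise disjoint subsets of $Y$, and for each $i\ge 1$ the servers of $Y_i^s$ with their radii $r$ form a $1$-cover of $\{x:\kappa(x)\ge 2i\}$ and those of $Y_i^p$ a $1$-cover of $\{x:\kappa(x)\ge 2i-1\}$. Procedures Cover as required exist. For example, the following primal–dual method is one. Consider the balls with centre $y\in Y'$ and radius $d(y,z)$, $z\in X'$; starting from $\beta=0$ on $X'$, raise the values $\beta_x$ one after another as far as possible subject to $\sum_{x\in X'\cap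 B}\beta_x\le\mathrm{rad}(B)^{\alpha}$ for all these balls $B$; among the balls with equality select greedily, by decreasing radius, balls that share no client with a selected one; finally triple the radii of the selected balls (radius $0$ at servers without a selected ball). -/

import Mathlib

open scoped NNReal

/-! # Programs with counted steps

`Prog β` is a nondeterministic program with output in `β`, on a unit-cost random access machine with
exact real arithmetic. Nondeterminism models the arbitrary choices (tie breaking, processing order,
"any" element) of an algorithm: `m.run b t` says that some resolution of the choices
makes `m` halt with output `b` after `t` elementary steps. An elementary step is a comparison
or arithmetic operation (including `x ↦ x ^ α`) on real numbers or integers, a comparison of two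
points, the evaluation of a distance or a demand, or a read or write of one memory cell. Finite sets
are stored as unordered lists of points, and tables indexed by points or by levels as arrays. The
numbers of steps that are charged below are worst-case bounds, up to an absolute constant factor,
for the straightforward implementation. -/

universe u v

namespace MMC

structure Prog (β : Type u) where
  run : β → ℕ → Prop

/-- Return `b` at the price of `n` elementary steps. -/
def steps {β : Type u} (n : ℕ) (b : β) : Prog β :=
  ⟨fun b' t => b' = b ∧ t = n⟩

/-- Sequential composition. -/
def Prog.bind {β : Type u} {γ : Type v} (m : Prog β) (f : β → Prog γ) : Prog γ :=
  ⟨fun c t => ∃ b t₁ t₂, m.run b t₁ ∧ (f b).run c t₂ ∧ t = t₁ + t₂⟩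

/-- An arbitrary element of `S`, or `none` when `S` is empty. -/
def pick {ι : Type u} (S : Finset ι) : Prog (Option ι) :=
  ⟨fun o t => t = 1 ∧ ((S = ∅ ∧ o = none) ∨ ∃ a ∈ S, o = some a)⟩

/-- The elements of `S` listed in an arbitrary order. -/
def enum {ι : Type u} (S : Finset ι) : Prog (List ι) :=
  ⟨fun L t => t = S.card + 1 ∧ L.Nodup ∧ ∀ a, a ∈ L ↔ a ∈ S⟩

/-- `for a in L do s ← body a s`. -/
def loop {ι : Type u} {σ : Type v} : List ι → σ → (ι → σ → Prog σ) → Prog σ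
  | [], s, _ => steps 1 s
  | a :: L, s, body => (steps 1 s).bind fun s => (body a s).bind fun s' => loop L s' body

open Classical in
/-- The elements of `S` that pass the test `p`, where one test takes at most `c` steps. -/
noncomputable def select {ι : Type u} (c : ℕ) (p : ι → Prop) (S : Finset ι) : Prog (Finset ι) :=
  steps (S.card * (c + 1) + 1) (S.filter p)

open Classical in
/-- Insertion of `a` into a list sorted by `le`. -/
noncomputable def insertSorted {ι : Type u} (le : ι → ι → Prop) (a : ι) : List ι → Prog (List ι)
  | [] => steps 1 [a]
  | b :: L =>
    if le a b then steps 8 (a :: b :: L)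
    else (insertSorted le a L).bind fun L' => steps 8 (b :: L')

/-- Insertion sort of a finite set with respect to `le`, with ties broken arbitrarily. -/
noncomputable def sortBy {ι : Type u} (le : ι → ι → Prop) (S : Finset ι) : Prog (List ι) :=
  (enum S).bind fun L => loop L [] fun a L' => insertSorted le a L'

/-! # Covers -/

section Covers

variable {M : Type u} [MetricSpace M]

open Classical in
/-- `X` is `κ`-covered by the balls of radius `r y` centred at the servers `y ∈ Y`. Only the values
of `κ` on `X` and of `r` on `Y` matter. -/
def IsCover (X Y : Finset M) (κ : M → ℕ) (r : M → ℝ≥0) : Prop :=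
  ∀ x ∈ X, κ x ≤ (Y.filter fun y => dist x y ≤ r y).card

/-- The cost of an assignment: the sum of the `α`-th powers of the radii. -/
noncomputable def cost (α : ℝ) (Y : Finset M) (r : M → ℝ≥0) : ℝ≥0 :=
  ∑ y ∈ Y, r y ^ α

end Covers

/-- A procedure that is given `α`, a set of clients and a set of servers, and returns radii for the
servers. -/
abbrev CoverProcedure : Type (u + 1) :=
  (M : Type u) → [MetricSpace M] → ℝ → Finset M → Finset M → Prog (M → ℝ≥0)

/-- The black box `Cover(X', Y', α)`: in polynomial time it returns a `1`-cover of `X'` by balls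
centred at servers of `Y'` whose cost is at most `3 ^ α` times the optimum. Nothing is required
when there is no `1`-cover at all, that is, when `Y'` is empty and `X'` is not. -/
def IsPolyTimeCover (Cover : CoverProcedure.{u}) : Prop :=
  ∃ p : Polynomial ℕ, ∀ (M : Type u) [MetricSpace M] (α : ℝ), 1 ≤ α →
    ∀ X' Y' : Finset M, (X'.Nonempty → Y'.Nonempty) →
      (∃ r t, (Cover M α X' Y').run r t) ∧
      ∀ r t, (Cover M α X' Y').run r t →
        t ≤ p.eval (X'.card + Y'.card) ∧
        IsCover X' Y' (fun _ => 1) r ∧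
        ∀ r', IsCover X' Y' (fun _ => 1) r' → cost α Y' r ≤ 3 ^ α * cost α Y' r'

/-! # A concrete procedure for `1`-covers

The primal-dual (local-ratio) method. The relevant balls are those with centre `y ∈ Y'` and
radius `dist y z`, `z ∈ X'`; such a ball is given by the pair `(y, z)`. -/

section PrimalDual

variable {M : Type u} [MetricSpace M]

open Classical in
noncomputable def ballClients (X' : Finset M) (b : M × M) : Finset M :=
  X'.filter fun x => dist b.1 x ≤ dist b.1 b.2

/-- The total dual value of the clients in a ball. -/
noncomputable def load (X' : Finset M) (β : M → ℝ≥0) (b : M × M) : ℝ≥0 :=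
  ∑ x ∈ ballClients X' b, β x

open Classical in
/-- The smallest slack of a ball containing `x`. -/
noncomputable def minSlack (α : ℝ) (X' Y' : Finset M) (β : M → ℝ≥0) (x : M) : ℝ≥0 :=
  let S := (Y' ×ˢ X').filter fun b => x ∈ ballClients X' b
  if h : S.Nonempty then S.inf' h fun b => nndist b.1 b.2 ^ α - load X' β b else 0

open Classical in
/-- Raise the dual variables one after another as far as possible; among the tight balls select
greedily, by decreasing radius, balls without common clients; triple the radii. -/
noncomputable def primalDualCover (α : ℝ) (X' Y' : Finset M) : Prog (M → ℝ≥0) :=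
  (enum X').bind fun L =>
  (loop L (fun _ => 0) fun x β =>
    (steps ((Y'.card * X'.card + 1) * (4 * X'.card + 8)) (minSlack α X' Y' β x)).bind fun s =>
    steps 1 (Function.update β x s)).bind fun β =>
  (select (4 * X'.card + 8) (fun b => load X' β b = nndist b.1 b.2 ^ α) (Y' ×ˢ X')).bind fun T =>
  (sortBy (fun b c => dist c.1 c.2 ≤ dist b.1 b.2) T).bind fun L =>
  (loop L (∅ : Finset (M × M)) fun b sel =>
    steps ((sel.card + 1) * (4 * X'.card + 8))
      (if ∀ c ∈ sel, Disjoint (ballClients X' b) (ballClients X' c) then insert b sel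
        else sel)).bind fun sel =>
  steps ((Y'.card + 1) * (4 * sel.card + 4)) fun y =>
    (sel.filter fun b => b.1 = y).sup fun b => 3 * nndist b.1 b.2

end PrimalDual

/-! # Partitioning the servers -/

section Partition

variable {M : Type u}

open Classical in
/-- For every client, the servers by increasing distance, with ties broken arbitrarily. The order
is computed once, so that all neighbourhoods of a client refer to the same order. -/
noncomputable def serverOrders [MetricSpace M] (X Y : Finset M) : Prog (M → List M) :=
  (enum X).bind fun L => loop L (fun _ => []) fun x ord =>
    (sortBy (fun y z => dist x y ≤ dist x z) Y).bind fun l => steps 1 (Function.update ord x l)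

open Classical in
/-- The set of the `j` nearest servers of `x`. -/
noncomputable def nbhd (ord : M → List M) (x : M) (j : ℕ) : Finset M :=
  ((ord x).take j).toFinset

/-- The client `x₂` threatens the client `x₁`. -/
def Threatens (κ : M → ℕ) (ord : M → List M) (x₂ x₁ : M) : Prop :=
  κ x₂ < κ x₁ ∧
    ¬ Disjoint (nbhd ord x₁ (κ x₁ - κ x₂ / 2)) (nbhd ord x₂ (κ x₂ - κ x₂ / 2))

open Classical in
/-- The clients are processed by non-increasing demand. An unmarked client is kept, and
all clients that threaten it are marked. The state is (kept clients, marked clients). -/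
noncomputable def filterClients (X Y : Finset M) (κ : M → ℕ) (ord : M → List M) :
    Prog (Finset M) :=
  (sortBy (fun x x' => κ x' ≤ κ x) X).bind fun L =>
  (loop L ((∅ : Finset M), (∅ : Finset M)) fun x s =>
    (steps (s.2.card + 1) (x ∈ s.2)).bind fun marked =>
    if marked then steps 1 s
    else (select ((Y.card + 2) ^ 2) (fun x₂ => Threatens κ ord x₂ x) X).bind fun T =>
      steps ((X.card + 1) ^ 2) (insert x s.1, s.2 ∪ T)).bind fun s =>
  steps 1 s.1

/-- Adjacency (of distinct clients) in the `i`-th graph. -/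
def Edge (κ : M → ℕ) (ord : M → List M) (i : ℕ) (x x' : M) : Prop :=
  i ≤ (κ x + 1) / 2 ∧ i ≤ (κ x' + 1) / 2 ∧
    ¬ Disjoint (nbhd ord x (κ x - (i - 1))) (nbhd ord x' (κ x' - (i - 1)))

open Classical in
/-- Adjacency lists of the subgraph of the `i`-th graph induced by the kept clients. -/
noncomputable def adjacency (Xbar Y : Finset M) (κ : M → ℕ) (ord : M → List M) (i : ℕ) :
    Prog (M → Finset M) :=
  (enum Xbar).bind fun L => loop L (fun _ => ∅) fun x nb =>
    (select ((Y.card + 2) ^ 2) (fun x' => x' ≠ x ∧ Edge κ ord i x x') Xbar).bind fun S =>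
    steps 1 (Function.update nb x S)

open Classical in
/-- The vertices within distance one of `S`. -/
noncomputable def withinOne (nb : M → Finset M) (S : Finset M) : Finset M :=
  S ∪ S.biUnion nb

open Classical in
/-- Extension of `net` to a 3-net: mark all vertices within distance two of the current set
and add an arbitrary unmarked vertex, until all vertices are marked (which takes at most
`|Xbar|` rounds; the remaining rounds change nothing). -/
noncomputable def growNet (Xbar : Finset M) (nb : M → Finset M) (net : Finset M) :
    Prog (Finset M) :=
  loop (List.range Xbar.card) net fun _ N =>
    (steps (2 * (Xbar.card + 1) ^ 3) (withinOne nb (withinOne nb N))).bind fun marked =>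
    (select Xbar.card (fun v => v ∉ marked) Xbar).bind fun U =>
    (pick U).bind fun v =>
    steps 1 (N ∪ v.toFinset)

open Classical in
/-- The hierarchy of 3-nets of levels `1, …, k`, each one extending the previous one. -/
noncomputable def netHierarchy (Xbar Y : Finset M) (κ : M → ℕ) (ord : M → List M) (k : ℕ) :
    Prog (ℕ → Finset M) :=
  loop (List.range' 1 k) (fun _ => ∅) fun i net =>
    (adjacency Xbar Y κ ord i).bind fun nb =>
    (growNet Xbar nb (net (i - 1))).bind fun N =>
    steps 1 (Function.update net i N)

/-- The available servers and the server subsets built so far. -/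
structure Subsets (M : Type u) where
  avail : Finset M
  shared : ℕ → Finset M
  priv : ℕ → Finset M

open Classical in
/-- If `2 * i ≤ κ x`, move the farthest available server among the `κ x - (i - 1)` nearest servers
of `x` to the `i`-th shared subset. "Farthest" refers to the fixed order of the servers. -/
noncomputable def takeShared (Y : Finset M) (κ : M → ℕ) (ord : M → List M) (i : ℕ) (x : M)
    (s : Subsets M) : Prog (Subsets M) :=
  if 2 * i ≤ κ x then
    (steps ((Y.card + 2) ^ 2)
      (((ord x).take (κ x - (i - 1))).filter fun y => y ∈ s.avail).getLast?).bind fun y =>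
    steps (2 * Y.card + 1)
      { s with
        avail := s.avail \ y.toFinset
        shared := Function.update s.shared i (s.shared i ∪ y.toFinset) }
  else steps 4 s

open Classical in
/-- If `2 * i - 1 ≤ κ x`, move any available private server of `x` to the `i`-th private subset. -/
noncomputable def takePrivate (Y : Finset M) (κ : M → ℕ) (ord : M → List M) (i : ℕ) (x : M)
    (s : Subsets M) : Prog (Subsets M) :=
  if 2 * i - 1 ≤ κ x then
    (steps ((Y.card + 2) ^ 2) (nbhd ord x ((κ x + 1) / 2) ∩ s.avail)).bind fun A =>
    (pick A).bind fun y =>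
    steps (2 * Y.card + 1)
      { s with
        avail := s.avail \ y.toFinset
        priv := Function.update s.priv i (s.priv i ∪ y.toFinset) }
  else steps 4 s

/-- `ComputeServerSubsets`, with `k` the largest demand. -/
noncomputable def computeServerSubsets [MetricSpace M] (X Y : Finset M) (κ : M → ℕ) (k : ℕ) :
    Prog (Subsets M) :=
  (serverOrders X Y).bind fun ord =>
  (filterClients X Y κ ord).bind fun Xbar =>
  (netHierarchy Xbar Y κ ord k).bind fun net =>
  (steps (Y.card + 1) (Subsets.mk Y (fun _ => ∅) (fun _ => ∅))).bind fun s₀ =>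
  loop (List.range' 1 ((k + 1) / 2)) s₀ fun i s =>
    (enum (net i)).bind fun L =>
    loop L s fun x s => (takeShared Y κ ord i x s).bind fun s => takePrivate Y κ ord i x s

end Partition

/-! # The algorithm -/

section Algorithm

variable {M : Type u} [MetricSpace M]

/-- The radii that are returned, together with the server subsets that were used. -/
structure Output (M : Type u) where
  radius : M → ℝ≥0
  shared : ℕ → Finset M
  priv : ℕ → Finset M

open Classical in
/-- Invoke `Cover` with servers `Y'` for the clients of demand at least `j`, and overwrite the
radii of the servers in `Y'`. -/
noncomputable def coverDemand (Cover : CoverProcedure.{u}) (α : ℝ) (X : Finset M) (κ : M → ℕ)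
    (j : ℕ) (Y' : Finset M) (r : M → ℝ≥0) : Prog (M → ℝ≥0) :=
  (select 4 (fun x => j ≤ κ x) X).bind fun Z =>
  (Cover M α Z Y').bind fun q =>
  steps (Y'.card + 1) fun y => if y ∈ Y' then q y else r y

open Classical in
/-- `NonUniformCover(X, Y, κ, α)`, with the subroutine `Cover`. -/
noncomputable def nonUniformCover (Cover : CoverProcedure.{u}) (α : ℝ) (X Y : Finset M)
    (κ : M → ℕ) : Prog (Output M) :=
  (steps (X.card + 1) (X.sup κ)).bind fun k =>
  (computeServerSubsets X Y κ k).bind fun F =>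
  (steps (Y.card + 1) fun _ => 0).bind fun r₀ =>
  (loop (List.range' 1 ((k + 1) / 2)) r₀ fun i r =>
    (if Even k ∨ i < (k + 1) / 2 then coverDemand Cover α X κ (2 * i) (F.shared i) r
      else steps 1 r).bind fun r =>
    coverDemand Cover α X κ (2 * i - 1) (F.priv i) r).bind fun r =>
  steps 1 ⟨r, F.shared, F.priv⟩

end Algorithm

end MMC

/-! The proof combines a loss bound for the construction of the server subsets with a charging
argument against an arbitrary cover.

Loss bound (`Plenty`). Before round i, every client x of a net X^j with j ≥ i and κ(x) ≥ 2j - 1 has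
lost at most i - 1 servers of N(x, κ(x) - (j - 1)). For j = i this leaves κ(x) - 2(i - 1) available
servers, enough for both picks of x (`Picks.exists_private` handles the second one). The bound
survives round i (`Picks.plenty_succ`). If x ∈ X^i, separation in G^i implies that only x takes
servers from its neighbourhood; since the shared pick is the farthest one, either it lies outside
the next smaller neighbourhood, or the server dropped from the neighbourhood had been lost before.
If x ∉ X^i, a private pick that hits x would produce an edge of G^j inside X^j or a threat inside
the filtered clients, and only one client of X^i is within one hop of x, so x loses at most one
shared pick.

Charging. Repeated greedy selection splits off from any κ-cover families A_0, A_1, … of balls with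
disjoint sets of centres, such that a client with κ(x) > j lies in a tripled ball of A_j whose
radius is at least the distance from x to each of its κ(x) - j nearest servers (`exists_families`).
A client of demand at least 2i (or 2i - 1) is joined to a client of X^i of demand at least 2i (or 2i
- 1) by three links, each being an equality or a common server at level i
(`Partitioned.exists_path`). The largest of the four balls of A_{i-1} that belong to these clients,
of radius ρ, has its centre within 9ρ of the client, and a server of the i-th subset is within 7ρ.
One server of radius 25ρ = (9 + 9 + 7)ρ therefore replaces the ball (`exists_cheap_cover`). The
families being disjoint, the optimal 1-covers of all shared subsets cost together at most 25^α times
the cover, and so do those of the private ones. With the factor 3^α of the black box this gives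
2·75^α, which is below 2·144^α. Since the subsets are disjoint, their 1-covers add up to a κ-cover
(`isCover_of_levels`).

The primal–dual black box is analysed by weak duality: the selected tight balls share no client, so
the sum of the α-th powers of their radii is at most the dual value. -/

namespace MMC

/-! # Total correctness with time bounds -/

/-- `m` halts for some resolution of its choices, and for every resolution it halts within `T`
steps with an output that satisfies `Q`. -/
def Meets {β : Type u} (m : Prog β) (T : ℕ) (Q : β → Prop) : Prop :=
  (∃ b t, m.run b t) ∧ ∀ b t, m.run b t → t ≤ T ∧ Q b

section Rules

variable {β : Type u} {γ : Type v}

theorem Meets.weaken {m : Prog β} {T T' : ℕ} {Q Q' : β → Prop} (h : Meets m T Q) (hT : T ≤ T')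
    (hQ : ∀ b, Q b → Q' b) : Meets m T' Q' :=
  ⟨h.1, fun b t hb => ⟨(h.2 b t hb).1.trans hT, hQ b (h.2 b t hb).2⟩⟩

theorem Meets.steps {n T : ℕ} {b : β} {Q : β → Prop} (hT : n ≤ T) (hQ : Q b) :
    Meets (MMC.steps n b) T Q :=
  ⟨⟨b, n, rfl, rfl⟩, by rintro _ _ ⟨rfl, rfl⟩; exact ⟨hT, hQ⟩⟩

theorem Meets.bind {m : Prog β} {f : β → Prog γ} {T₁ T₂ T : ℕ} {Q : β → Prop} {R : γ → Prop}
    (hm : Meets m T₁ Q) (hf : ∀ b, Q b → Meets (f b) T₂ R) (hT : T₁ + T₂ ≤ T) :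
    Meets (m.bind f) T R := by
  obtain ⟨⟨b, t, hb⟩, h⟩ := hm
  obtain ⟨⟨c, t', hc⟩, -⟩ := hf b (h b t hb).2
  refine ⟨⟨c, _, b, t, t', hb, hc, rfl⟩, ?_⟩
  rintro c _ ⟨b, t₁, t₂, hb, hc, rfl⟩
  have h1 := h b t₁ hb
  have h2 := (hf b h1.2).2 c t₂ hc
  exact ⟨by omega, h2.2⟩

theorem Meets.steps_bind {n T₂ T : ℕ} {b : β} {f : β → Prog γ} {R : γ → Prop}
    (hf : Meets (f b) T₂ R) (hT : n + T₂ ≤ T) : Meets ((MMC.steps n b).bind f) T R :=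
  Meets.bind (Q := fun b' => b' = b) (Meets.steps le_rfl rfl) (by rintro _ rfl; exact hf) hT

theorem meets_enum (S : Finset β) :
    Meets (enum S) (S.card + 1) fun L => L.Nodup ∧ L.length = S.card ∧ ∀ a, a ∈ L ↔ a ∈ S := by
  refine ⟨⟨S.toList, _, rfl, S.nodup_toList, fun a => S.mem_toList⟩, ?_⟩
  rintro L t ⟨rfl, hL, h⟩
  refine ⟨le_rfl, hL, ?_, h⟩
  classical
  rw [← List.toFinset_card_of_nodup hL]
  congr 1
  ext a
  simp [h]

theorem meets_pick (S : Finset β) :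
    Meets (pick S) 1 fun o => (S = ∅ ∧ o = none) ∨ ∃ a ∈ S, o = some a := by
  refine ⟨?_, fun o t h => ⟨h.1.le, h.2⟩⟩
  rcases S.eq_empty_or_nonempty with h | ⟨a, h⟩
  · exact ⟨none, 1, rfl, .inl ⟨h, rfl⟩⟩
  · exact ⟨some a, 1, rfl, .inr ⟨a, h, rfl⟩⟩

theorem Meets.select_bind {c T₂ T : ℕ} {p : β → Prop} {S : Finset β} {f : Finset β → Prog γ}
    {R : γ → Prop} (hf : ∀ A : Finset β, (∀ a, a ∈ A ↔ a ∈ S ∧ p a) → Meets (f A) T₂ R)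
    (hT : S.card * (c + 1) + 1 + T₂ ≤ T) : Meets ((select c p S).bind f) T R :=
  Meets.steps_bind (hf _ fun _ => by classical exact Finset.mem_filter) hT

theorem meets_loop_append {σ : Type v} {body : β → σ → Prog σ} {T : ℕ} (I : List β → σ → Prop)
    (L : List β) : ∀ (D : List β) (s : σ), I D s →
      (∀ D' a E s, D ++ L = D' ++ a :: E → I D' s → Meets (body a s) T (I (D' ++ [a]))) →
      Meets (loop L s body) (L.length * (T + 1) + 1) (I (D ++ L)) := by
  induction L with
  | nil =>
    intro D s h _
    exact Meets.steps (by simp) (by simpa using h)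
  | cons a L ih =>
    intro D s h hbody
    refine Meets.steps_bind (T₂ := T + (L.length * (T + 1) + 1)) ?_ ?_
    · refine (hbody D a L s rfl h).bind (fun s' hs' => ?_) le_rfl
      have := ih (D ++ [a]) s' hs' (by simpa using hbody)
      simpa using this
    · simp only [List.length_cons]
      ring_nf
      omega

/-- Invariants `I D s` of a loop; `D` is the part of the list that has been processed. -/
theorem meets_loop {σ : Type v} {body : β → σ → Prog σ} {T : ℕ} (I : List β → σ → Prop)
    {L : List β} {s : σ} (h : I [] s)
    (hbody : ∀ D a E s, L = D ++ a :: E → I D s → Meets (body a s) T (I (D ++ [a]))) :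
    Meets (loop L s body) (L.length * (T + 1) + 1) (I L) := by
  simpa using meets_loop_append I L [] s h (by simpa using hbody)

theorem meets_loop_of_le {σ : Type v} {body : β → σ → Prog σ} {T N : ℕ} (I : List β → σ → Prop)
    {L : List β} {s : σ} (hL : L.length ≤ N) (h : I [] s)
    (hbody : ∀ D a E s, L = D ++ a :: E → I D s → Meets (body a s) T (I (D ++ [a]))) :
    Meets (loop L s body) (N * (T + 1) + 1) (I L) :=
  (meets_loop I h hbody).weaken (by gcongr) fun _ => id

/-- Invariants `I i s` of a loop over `i = 1, …, l`, at the beginning of round `i`. -/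
theorem meets_loop_range' {σ : Type v} {body : ℕ → σ → Prog σ} {T : ℕ} (I : ℕ → σ → Prop)
    {l : ℕ} {s : σ} (h : I 1 s)
    (hbody : ∀ i s, 1 ≤ i → i ≤ l → I i s → Meets (body i s) T (I (i + 1))) :
    Meets (loop (List.range' 1 l) s body) (l * (T + 1) + 1) (I (l + 1)) := by
  have := meets_loop (β := ℕ) (T := T) (body := body) (fun D s => I (D.length + 1) s)
    (L := List.range' 1 l) (s := s) h ?_
  · simpa using this
  · intro D a E s hL hI
    have hlen := congrArg List.length hL
    simp only [List.length_range', List.length_append, List.length_cons] at hlen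
    have ha : a = D.length + 1 := by
      have h1 : (List.range' 1 l)[D.length]? = some a := by simp [hL]
      rw [List.getElem?_range' (by omega)] at h1
      simp at h1
      omega
    have := hbody a s (by omega) (by omega) (by rw [ha]; exact hI)
    simpa [ha] using this

end Rules

/-! ### Insertion sort with respect to a total preorder. -/

section Sorting

variable {ι : Type u} {le : ι → ι → Prop}

theorem meets_insertSorted (htot : ∀ a b, le a b ∨ le b a)
    (htrans : ∀ a b c, le a b → le b c → le a c) (a : ι) (L : List ι) (hL : L.Pairwise le) :
    Meets (insertSorted le a L) (8 * (L.length + 1)) fun L' =>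
      L'.Perm (a :: L) ∧ L'.Pairwise le := by
  induction L with
  | nil => exact Meets.steps (by simp) (by simp)
  | cons b L ih =>
    rw [insertSorted]
    rw [List.pairwise_cons] at hL
    split_ifs with h
    · refine Meets.steps (by simp) ⟨List.Perm.refl _, ?_⟩
      rw [List.pairwise_cons, List.pairwise_cons]
      refine ⟨fun c hc => ?_, hL⟩
      rcases List.mem_cons.1 hc with rfl | hc
      · exact h
      · exact htrans _ _ _ h (hL.1 c hc)
    · refine (ih hL.2).bind (T₂ := 8) (fun L' h' => Meets.steps le_rfl ⟨?_, ?_⟩)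
        (by simp; omega)
      · exact (h'.1.cons b).trans (List.Perm.swap a b L)
      · rw [List.pairwise_cons]
        refine ⟨fun c hc => ?_, h'.2⟩
        rcases List.mem_cons.1 (h'.1.mem_iff.1 hc) with rfl | hc
        · exact (htot c b).resolve_left h
        · exact hL.1 c hc

theorem meets_sortBy (htot : ∀ a b, le a b ∨ le b a)
    (htrans : ∀ a b c, le a b → le b c → le a c) (S : Finset ι) :
    Meets (sortBy le S) (8 * (S.card + 2) ^ 2) fun L =>
      L.Nodup ∧ L.length = S.card ∧ (∀ a, a ∈ L ↔ a ∈ S) ∧ L.Pairwise le := by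
  refine (meets_enum S).bind (T₂ := S.card * (8 * (S.card + 1) + 1) + 1) (fun L hL => ?_)
    (by ring_nf; omega)
  have := meets_loop (T := 8 * (S.card + 1)) (body := fun a L' => insertSorted le a L')
    (fun D L' => L'.Perm D ∧ L'.Pairwise le) (L := L) (s := []) (by simp)
    (fun D a E L' hD h => by
      refine (meets_insertSorted htot htrans a L' h.2).weaken ?_ fun L'' h' => ⟨?_, h'.2⟩
      · have h1 := congrArg List.length hD
        have h2 := h.1.length_eq
        simp only [List.length_append, List.length_cons] at h1
        omega
      · exact h'.1.trans ((h.1.cons a).trans (List.perm_append_singleton a D).symm))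
  rw [hL.2.1] at this
  refine this.weaken le_rfl fun L' h => ⟨h.1.nodup_iff.2 hL.1, h.1.length_eq.trans hL.2.1,
    fun a => (h.1.mem_iff).trans (hL.2.2 a), h.2⟩

end Sorting

/-! # The primal-dual method -/

open Classical in
/-- Merging balls `b ∈ B` of radius `ρ b` with the same centre `f b`. -/
theorem cost_sup_le {M : Type u} {ι : Type v} {α : ℝ} (hα : 1 ≤ α) {Y' : Finset M} {B : Finset ι} {f : ι → M}
    (hf : ∀ b ∈ B, f b ∈ Y') (ρ : ι → ℝ≥0) :
    cost α Y' (fun y => (B.filter fun b => f b = y).sup ρ) ≤ ∑ b ∈ B, ρ b ^ α := by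
  have hpos : 0 < α := by linarith
  calc _ ≤ ∑ y ∈ Y', ∑ b ∈ B.filter fun b => f b = y, ρ b ^ α := Finset.sum_le_sum fun y _ => ?_
    _ = ∑ b ∈ B, ρ b ^ α := Finset.sum_fiberwise_of_maps_to hf _
  rcases (B.filter fun b => f b = y).eq_empty_or_nonempty with he | hne
  · simp [he, NNReal.zero_rpow hpos.ne']
  · obtain ⟨b, hb, hbe⟩ := Finset.exists_mem_eq_sup _ hne ρ
    simp only [hbe]
    exact Finset.single_le_sum (f := fun b => ρ b ^ α) (fun _ _ => zero_le) hb

section PrimalDual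

variable {M : Type u} [MetricSpace M]

theorem mem_ballClients {X' : Finset M} {b : M × M} {x : M} :
    x ∈ ballClients X' b ↔ x ∈ X' ∧ dist b.1 x ≤ dist b.1 b.2 := by
  classical
  simp [ballClients]

theorem load_update_of_mem {X' : Finset M} {β : M → ℝ≥0} {x : M} [DecidableEq M] (hx : β x = 0)
    (s : ℝ≥0) {b : M × M} (hb : x ∈ ballClients X' b) :
    load X' (Function.update β x s) b = load X' β b + s := by
  have : Function.update β x s = β + Pi.single x s := by
    ext z
    rcases eq_or_ne z x with rfl | h
    · simp [hx]
    · simp [h]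
  simp only [load, this, Pi.add_apply, Finset.sum_add_distrib, Finset.sum_pi_single', if_pos hb]

theorem load_update_of_notMem {X' : Finset M} {β : M → ℝ≥0} {x : M} [DecidableEq M]
    (s : ℝ≥0) {b : M × M} (hb : x ∉ ballClients X' b) :
    load X' (Function.update β x s) b = load X' β b := by
  refine Finset.sum_congr rfl fun z hz => ?_
  rw [Function.update_of_ne]
  rintro rfl
  exact hb hz

/-- Feasible dual values `β` that are zero outside `D` and maximal on `D`. -/
structure DualMaximal (α : ℝ) (X' Y' : Finset M) (D : List M) (β : M → ℝ≥0) : Prop where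
  zero : ∀ x, x ∉ D → β x = 0
  feasible : ∀ b ∈ Y' ×ˢ X', load X' β b ≤ nndist b.1 b.2 ^ α
  tight : ∀ x ∈ D, ∃ b ∈ Y' ×ˢ X', x ∈ ballClients X' b ∧ load X' β b = nndist b.1 b.2 ^ α

-- The ball `(y, x)` contains `x`, so the minimal slack is a genuine minimum. Raising `β x` by it
-- violates no constraint and makes a ball attaining the minimum tight. Balls that were tight remain
-- so, because loads only grow and stay feasible.
open Classical in
theorem DualMaximal.raise {α : ℝ} {X' Y' : Finset M} {D : List M} {β : M → ℝ≥0}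
    (h : DualMaximal α X' Y' D β) {x : M} (hx : x ∈ X') (hxD : x ∉ D) (hY : Y'.Nonempty) :
    DualMaximal α X' Y' (D ++ [x]) (Function.update β x (minSlack α X' Y' β x)) := by
  set s := minSlack α X' Y' β x with hs
  have h0 := h.zero x hxD
  set S := (Y' ×ˢ X').filter fun b => x ∈ ballClients X' b with hS
  have hne : S.Nonempty := by
    obtain ⟨y, hy⟩ := hY
    exact ⟨(y, x), by simp [hS, hy, hx, mem_ballClients]⟩
  have hs' : s = S.inf' hne fun b => nndist b.1 b.2 ^ α - load X' β b := by
    rw [hs, minSlack]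
    exact dif_pos hne
  have hle : ∀ b ∈ Y' ×ˢ X', x ∈ ballClients X' b →
      load X' β b + s ≤ nndist b.1 b.2 ^ α := fun b hb hxb => by
    have h1 : s ≤ nndist b.1 b.2 ^ α - load X' β b := by
      rw [hs']
      exact Finset.inf'_le (fun b => nndist b.1 b.2 ^ α - load X' β b)
        (Finset.mem_filter.2 ⟨hb, hxb⟩)
    calc _ ≤ load X' β b + (nndist b.1 b.2 ^ α - load X' β b) := by gcongr
      _ = _ := add_tsub_cancel_of_le (h.feasible b hb)
  have hfeas : ∀ b ∈ Y' ×ˢ X', load X' (Function.update β x s) b ≤ nndist b.1 b.2 ^ α := by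
    intro b hb
    by_cases hxb : x ∈ ballClients X' b
    · rw [load_update_of_mem h0 s hxb]
      exact hle b hb hxb
    · rw [load_update_of_notMem s hxb]
      exact h.feasible b hb
  refine ⟨fun z hz => ?_, hfeas, fun z hz => ?_⟩
  · simp only [List.mem_append, List.mem_singleton, not_or] at hz
    rw [Function.update_of_ne hz.2]
    exact h.zero z hz.1
  · rcases List.mem_append.1 hz with hz | hz
    · obtain ⟨b, hb, hzb, ht⟩ := h.tight z hz
      refine ⟨b, hb, hzb, (hfeas b hb).antisymm ?_⟩
      rw [← ht]
      by_cases hxb : x ∈ ballClients X' b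
      · rw [load_update_of_mem h0 s hxb]
        exact le_self_add
      · rw [load_update_of_notMem s hxb]
    · obtain rfl : z = x := by simpa using hz
      obtain ⟨b, hb, hbs⟩ := Finset.exists_mem_eq_inf' hne
        fun b => nndist b.1 b.2 ^ α - load X' β b
      rw [hS, Finset.mem_filter] at hb
      refine ⟨b, hb.1, hb.2, ?_⟩
      rw [load_update_of_mem h0 s hb.2, hs', hbs]
      exact add_tsub_cancel_of_le (h.feasible b hb.1)

/-- Weak duality. -/
theorem sum_le_cost {α : ℝ} (hα : 1 ≤ α) {X' Y' : Finset M} {β : M → ℝ≥0}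
    (h : ∀ b ∈ Y' ×ˢ X', load X' β b ≤ nndist b.1 b.2 ^ α) {r : M → ℝ≥0}
    (hr : IsCover X' Y' (fun _ => 1) r) : ∑ x ∈ X', β x ≤ cost α Y' r := by
  classical
  have hpos : 0 ≤ α := by linarith
  calc ∑ x ∈ X', β x ≤ ∑ x ∈ X', ∑ y ∈ Y', if dist x y ≤ r y then β x else 0 :=
        Finset.sum_le_sum fun x hx => by
          obtain ⟨y, hy⟩ := Finset.card_pos.1 (Nat.lt_of_lt_of_le Nat.zero_lt_one (hr x hx))
          rw [Finset.mem_filter] at hy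
          refine le_trans ?_ (Finset.single_le_sum (fun _ _ => zero_le) hy.1)
          rw [if_pos hy.2]
    _ = ∑ y ∈ Y', ∑ x ∈ X'.filter fun x => dist x y ≤ r y, β x := by
        rw [Finset.sum_comm]
        exact Finset.sum_congr rfl fun y _ => (Finset.sum_filter _ _).symm
    _ ≤ ∑ y ∈ Y', r y ^ α := Finset.sum_le_sum fun y hy => ?_
  rcases (X'.filter fun x => dist x y ≤ r y).eq_empty_or_nonempty with he | hne
  · rw [he]
    simp
  -- With `z` the farthest client covered by `y`, the relevant ball `(y, z)` contains all clients
  -- covered by `y` and has radius at most `r y`.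
  · obtain ⟨z, hz, hmax⟩ := Finset.exists_max_image _ (fun x => dist x y) hne
    have hz' := Finset.mem_filter.1 hz
    calc _ ≤ load X' β (y, z) := Finset.sum_le_sum_of_subset fun x hx =>
          mem_ballClients.2 ⟨(Finset.mem_filter.1 hx).1, by
            simpa [dist_comm] using hmax x hx⟩
      _ ≤ nndist y z ^ α := h (y, z) (by simp [hy, hz'.1])
      _ ≤ r y ^ α := NNReal.rpow_le_rpow (by
          rw [nndist_comm]; exact_mod_cast hz'.2) hpos

/-- Balls `sel` selected greedily from a list of balls of decreasing radius. -/
structure GreedySelection (X' : Finset M) (D : List (M × M)) (sel : Finset (M × M)) : Prop where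
  subset : ∀ b ∈ sel, b ∈ D
  disj : ∀ b ∈ sel, ∀ c ∈ sel, b ≠ c → Disjoint (ballClients X' b) (ballClients X' c)
  meet : ∀ b ∈ D, (ballClients X' b).Nonempty → ∃ c ∈ sel,
    ¬ Disjoint (ballClients X' b) (ballClients X' c) ∧ dist b.1 b.2 ≤ dist c.1 c.2

-- A rejected ball meets a ball selected earlier, which is at least as large because of the
-- processing order. A selected nonempty ball meets itself.
open Classical in
theorem GreedySelection.step {X' : Finset M} {D : List (M × M)} {sel : Finset (M × M)}
    (h : GreedySelection X' D sel) (b : M × M) (hb : ∀ c ∈ D, dist b.1 b.2 ≤ dist c.1 c.2) :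
    GreedySelection X' (D ++ [b])
      (if ∀ c ∈ sel, Disjoint (ballClients X' b) (ballClients X' c) then insert b sel
        else sel) := by
  split_ifs with hd
  · refine ⟨fun c hc => ?_, fun c hc e he hce => ?_, fun c hc hne => ?_⟩
    · rcases Finset.mem_insert.1 hc with rfl | hc
      · simp
      · simp [h.subset c hc]
    · rcases Finset.mem_insert.1 hc with hc | hc <;> rcases Finset.mem_insert.1 he with he | he
      · exact absurd (hc.trans he.symm) hce
      · exact hc ▸ hd e he
      · exact he ▸ (hd c hc).symm
      · exact h.disj c hc e he hce
    · rcases List.mem_append.1 hc with hc | hc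
      · obtain ⟨e, he, h'⟩ := h.meet c hc hne
        exact ⟨e, Finset.mem_insert_of_mem he, h'⟩
      · obtain rfl : c = b := by simpa using hc
        exact ⟨c, Finset.mem_insert_self _ _, by simpa [Finset.nonempty_iff_ne_empty] using hne,
          le_rfl⟩
  · refine ⟨fun c hc => by simp [h.subset c hc], h.disj, fun c hc hne => ?_⟩
    rcases List.mem_append.1 hc with hc | hc
    · exact h.meet c hc hne
    · obtain rfl : c = b := by simpa using hc
      push Not at hd
      obtain ⟨e, he, h'⟩ := hd
      exact ⟨e, he, h', hb e (h.subset e he)⟩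

open Classical in
/-- The radii that are obtained by tripling the selected balls. -/
noncomputable def tripled (sel : Finset (M × M)) (y : M) : ℝ≥0 :=
  (sel.filter fun b => b.1 = y).sup fun b => 3 * nndist b.1 b.2

/-- A listed ball `b` containing `x` shares a client `w` with a selected ball `c` that is no
smaller. The path from `x` through the centre of `b` and through `w` to the centre of `c` has length
at most three times the radius of `c`. -/
theorem isCover_tripled {X' Y' : Finset M} {D : List (M × M)} {sel : Finset (M × M)}
    (h : GreedySelection X' D sel) (hD : ∀ b ∈ D, b ∈ Y' ×ˢ X')
    (hX : ∀ x ∈ X', ∃ b ∈ D, x ∈ ballClients X' b) :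
    IsCover X' Y' (fun _ => 1) (tripled sel) := by
  classical
  intro x hx
  obtain ⟨b, hb, hxb⟩ := hX x hx
  obtain ⟨c, hc, hbc, hle⟩ := h.meet b hb ⟨x, hxb⟩
  obtain ⟨w, hwb, hwc⟩ := Finset.not_disjoint_iff.1 hbc
  refine Finset.card_pos.2 ⟨c.1, Finset.mem_filter.2
    ⟨(Finset.mem_product.1 (hD c (h.subset c hc))).1, ?_⟩⟩
  have h1 : 3 * nndist c.1 c.2 ≤ tripled sel c.1 := by
    rw [tripled]
    exact Finset.le_sup (f := fun b : M × M => 3 * nndist b.1 b.2)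
      (Finset.mem_filter.2 ⟨hc, rfl⟩)
  have h1' : 3 * dist c.1 c.2 ≤ tripled sel c.1 := by exact_mod_cast h1
  have hxb' := (mem_ballClients.1 hxb).2
  have hwb' := (mem_ballClients.1 hwb).2
  have hwc' := (mem_ballClients.1 hwc).2
  have h2 := dist_triangle4 x b.1 w c.1
  rw [dist_comm x b.1, dist_comm w c.1] at h2
  linarith

/-- Tightness turns the powers of the radii into loads, and disjointness makes every dual value
count at most once. -/
theorem cost_tripled_le {α : ℝ} (hα : 1 ≤ α) {X' Y' : Finset M} {β : M → ℝ≥0}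
    {D : List (M × M)} {sel : Finset (M × M)}
    (h : GreedySelection X' D sel) (hD : ∀ b ∈ D, b ∈ Y' ×ˢ X')
    (ht : ∀ b ∈ D, load X' β b = nndist b.1 b.2 ^ α) :
    cost α Y' (tripled sel) ≤ 3 ^ α * ∑ x ∈ X', β x := by
  classical
  calc cost α Y' (tripled sel) ≤ ∑ b ∈ sel, (3 * nndist b.1 b.2) ^ α :=
        cost_sup_le hα (fun b hb => (Finset.mem_product.1 (hD b (h.subset b hb))).1) _
    _ = 3 ^ α * ∑ b ∈ sel, load X' β b := by
        rw [Finset.mul_sum]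
        exact Finset.sum_congr rfl fun b hb => by
          rw [NNReal.mul_rpow, ht b (h.subset b hb)]
    _ = 3 ^ α * ∑ x ∈ sel.biUnion (ballClients X'), β x := by
        rw [Finset.sum_biUnion fun b hb c hc hbc => h.disj b hb c hc hbc]
        rfl
    _ ≤ 3 ^ α * ∑ x ∈ X', β x := by
        gcongr
        intro x hx
        obtain ⟨b, -, hx⟩ := Finset.mem_biUnion.1 hx
        exact (mem_ballClients.1 hx).1

/-- The exponent 5 comes from the greedy selection: at most n² tight balls, each compared with at
most n² selected ones in O(n) steps. The decreasing budgets 900, 800, … only leave room for the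
successive phases. -/
theorem meets_primalDualCover {α : ℝ} (hα : 1 ≤ α) (X' Y' : Finset M)
    (hne : X'.Nonempty → Y'.Nonempty) {n : ℕ} (hn : X'.card + Y'.card ≤ n) :
    Meets (primalDualCover α X' Y') (1000 * (n + 2) ^ 5) fun r =>
      IsCover X' Y' (fun _ => 1) r ∧
      ∀ r', IsCover X' Y' (fun _ => 1) r' → cost α Y' r ≤ 3 ^ α * cost α Y' r' := by
  classical
  have hX : X'.card ≤ n := by omega
  have hY : Y'.card ≤ n := by omega
  have hYX : Y'.card * X'.card ≤ n * n := Nat.mul_le_mul hY hX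
  refine (meets_enum X').bind (T₂ := 900 * (n + 2) ^ 5) (fun L hL => ?_) ?_
  swap
  · ring_nf
    linarith only [hX, Nat.zero_le n, Nat.zero_le (n ^ 2), Nat.zero_le (n ^ 3), Nat.zero_le (n ^ 4),
      Nat.zero_le (n ^ 5)]
  refine (meets_loop (T := (n * n + 1) * (4 * n + 8) + 1)
    (fun D β => DualMaximal α X' Y' D β) ⟨by simp, ?_, by simp⟩ ?_).bind
    (T₂ := 800 * (n + 2) ^ 5) (fun β hβ => ?_) ?_
  · intro b hb
    simp [load]
  · intro D x E β hD h
    have hx : x ∈ X' := (hL.2.2 x).1 (by simp [hD])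
    have hnd := hL.1
    rw [hD] at hnd
    have hxD : x ∉ D := fun hxD => by
      have := (List.nodup_append.1 hnd).2.2 x hxD x (by simp)
      exact this rfl
    refine Meets.steps_bind (T₂ := 1) (Meets.steps le_rfl (h.raise hx hxD (hne ⟨x, hx⟩))) ?_
    gcongr
  swap
  · have : L.length * ((n * n + 1) * (4 * n + 8) + 1 + 1) ≤
        n * ((n * n + 1) * (4 * n + 8) + 1 + 1) := by
      rw [hL.2.1]; gcongr
    refine (Nat.add_le_add_right (Nat.add_le_add_right this 1) _).trans ?_
    ring_nf
    linarith only [hX, Nat.zero_le n, Nat.zero_le (n ^ 2), Nat.zero_le (n ^ 3), Nat.zero_le (n ^ 4),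
      Nat.zero_le (n ^ 5)]
  refine Meets.select_bind (T₂ := 700 * (n + 2) ^ 5) (fun T hmemT => ?_) ?_
  swap
  · have : (Y' ×ˢ X').card * (4 * X'.card + 8 + 1) ≤ n * n * (4 * n + 8 + 1) := by
      rw [Finset.card_product]; gcongr
    refine (Nat.add_le_add_right (Nat.add_le_add_right this 1) _).trans ?_
    ring_nf
    linarith only [hX, Nat.zero_le n, Nat.zero_le (n ^ 2), Nat.zero_le (n ^ 3), Nat.zero_le (n ^ 4),
      Nat.zero_le (n ^ 5)]
  have hTc : T.card ≤ n * n := by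
    refine (Finset.card_le_card fun b hb => ((hmemT b).1 hb).1).trans ?_
    rwa [Finset.card_product]
  refine (meets_sortBy (le := fun b c => dist c.1 c.2 ≤ dist b.1 b.2)
    (fun b c => le_total _ _) (fun a b c hab hbc => hbc.trans hab) T).bind
    (T₂ := 600 * (n + 2) ^ 5) (fun L' hL' => ?_) ?_
  swap
  · have : 8 * (T.card + 2) ^ 2 ≤ 8 * (n * n + 2) ^ 2 := by gcongr
    refine (Nat.add_le_add_right this _).trans ?_
    ring_nf
    linarith only [hX, Nat.zero_le n, Nat.zero_le (n ^ 2), Nat.zero_le (n ^ 3), Nat.zero_le (n ^ 4),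
      Nat.zero_le (n ^ 5)]
  refine (meets_loop (T := (n * n + 1) * (4 * n + 8)) (GreedySelection X')
    ⟨by simp, by simp, by simp⟩ ?_).bind (T₂ := 500 * (n + 2) ^ 5) (fun sel hsel => ?_) ?_
  · intro D b E sel hD h
    have hc : sel.card ≤ n * n := by
      refine (Finset.card_le_card fun b hb => ?_).trans hTc
      exact (hL'.2.2.1 b).1 (by simp [hD, h.subset b hb])
    refine Meets.steps ?_ (h.step b fun c hc => ?_)
    · gcongr
    · have := hL'.2.2.2
      rw [hD, List.pairwise_append] at this
      exact this.2.2 c hc b (by simp)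
  swap
  · have : L'.length * ((n * n + 1) * (4 * n + 8) + 1) ≤
        n * n * ((n * n + 1) * (4 * n + 8) + 1) := by
      rw [hL'.2.1]; gcongr
    refine (Nat.add_le_add_right (Nat.add_le_add_right this 1) _).trans ?_
    ring_nf
    linarith only [hX, Nat.zero_le n, Nat.zero_le (n ^ 2), Nat.zero_le (n ^ 3), Nat.zero_le (n ^ 4),
      Nat.zero_le (n ^ 5)]
  have hmem : ∀ b ∈ L', b ∈ Y' ×ˢ X' ∧ load X' β b = nndist b.1 b.2 ^ α := fun b hb =>
    (hmemT b).1 ((hL'.2.2.1 b).1 hb)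
  refine Meets.steps ?_ ⟨?_, fun r' hr' => ?_⟩
  · have hc : sel.card ≤ n * n :=
      (Finset.card_le_card fun b hb => (hL'.2.2.1 b).1 (hsel.subset b hb)).trans hTc
    have : (Y'.card + 1) * (4 * sel.card + 4) ≤ (n + 1) * (4 * (n * n) + 4) := by gcongr
    refine this.trans ?_
    ring_nf
    linarith only [hX, Nat.zero_le n, Nat.zero_le (n ^ 2), Nat.zero_le (n ^ 3), Nat.zero_le (n ^ 4),
      Nat.zero_le (n ^ 5)]
  · refine isCover_tripled hsel (fun b hb => (hmem b hb).1) fun x hx => ?_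
    obtain ⟨b, hb, hxb, ht⟩ := hβ.tight x ((hL.2.2 x).2 hx)
    exact ⟨b, (hL'.2.2.1 b).2 ((hmemT b).2 ⟨hb, ht⟩), hxb⟩
  · refine (cost_tripled_le hα hsel (fun b hb => (hmem b hb).1)
      fun b hb => (hmem b hb).2).trans ?_
    gcongr
    exact sum_le_cost hα hβ.feasible hr'

theorem isPolyTimeCover_primalDualCover :
    IsPolyTimeCover.{u} (fun _ _ α X' Y' => primalDualCover α X' Y') := by
  refine ⟨1000 * (Polynomial.X + 2) ^ 5, fun M _ α hα X' Y' hne => ?_⟩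
  have := meets_primalDualCover hα X' Y' hne le_rfl
  refine ⟨this.1, fun r t h => ?_⟩
  simpa using this.2 r t h

end PrimalDual

/-! # Server orders -/

section Orders

variable {M : Type u} [MetricSpace M]

/-- For every client in `X`, the list `ord x` contains the servers by increasing distance. -/
structure ServerOrder (X Y : Finset M) (ord : M → List M) : Prop where
  nodup : ∀ x ∈ X, (ord x).Nodup
  mem : ∀ x ∈ X, ∀ y, y ∈ ord x ↔ y ∈ Y
  sorted : ∀ x ∈ X, (ord x).Pairwise fun y z => dist x y ≤ dist x z

theorem meets_serverOrders (X Y : Finset M) {n : ℕ} (hX : X.card ≤ n) (hY : Y.card ≤ n) :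
    Meets (serverOrders X Y) (20 * (n + 2) ^ 3) (ServerOrder X Y) := by
  classical
  refine (meets_enum X).bind (T₂ := 19 * (n + 2) ^ 3) (fun L hL => ?_) (by ring_nf; omega)
  refine (meets_loop_of_le (N := n) (T := 8 * (n + 2) ^ 2 + 1)
    (fun D => ServerOrder D.toFinset Y) (by omega) ⟨by simp, by simp, by simp⟩ ?_).weaken
    (by ring_nf; omega) ?_
  · intro D x E ord hD h
    refine (meets_sortBy (le := fun y z => dist x y ≤ dist x z) (fun _ _ => le_total _ _)
      (fun _ _ _ => le_trans) Y).bind (T₂ := 1) (fun l hl => Meets.steps le_rfl ?_)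
      (by gcongr)
    have key : ∀ z ∈ (D ++ [x]).toFinset, Function.update ord x l z = l ∧ z = x ∨
        Function.update ord x l z = ord z ∧ z ∈ D.toFinset := by
      intro z hz
      by_cases hzx : z = x
      · exact .inl ⟨by rw [hzx, Function.update_self], hzx⟩
      · refine .inr ⟨by rw [Function.update_of_ne hzx], ?_⟩
        simpa [hzx] using hz
    refine ⟨fun z hz => ?_, fun z hz => ?_, fun z hz => ?_⟩ <;>
      rcases key z hz with ⟨h1, h2⟩ | ⟨h1, h2⟩ <;> (try subst h2) <;> rw [h1]
    · exact hl.1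
    · exact h.nodup z h2
    · exact hl.2.2.1
    · exact h.mem z h2
    · exact hl.2.2.2
    · exact h.sorted z h2
  · intro ord h
    have : L.toFinset = X := by ext; simp [hL.2.2]
    rwa [this] at h

end Orders

/-! ### Sets of nearest servers in the fixed orders. -/

section Neighbourhoods

variable {M : Type u} {ord : M → List M}

theorem mem_nbhd {x y : M} {j : ℕ} : y ∈ nbhd ord x j ↔ y ∈ (ord x).take j := by
  simp [nbhd]

theorem nbhd_mono (x : M) {i j : ℕ} (h : i ≤ j) : nbhd ord x i ⊆ nbhd ord x j := fun y hy => by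
  rw [mem_nbhd] at *
  exact (List.take_subset_take_left _ h) hy

variable [MetricSpace M] {X Y : Finset M}

theorem ServerOrder.nbhd_subset (h : ServerOrder X Y ord) {x : M} (hx : x ∈ X) (j : ℕ) :
    nbhd ord x j ⊆ Y := fun y hy =>
  (h.mem x hx y).1 (List.mem_of_mem_take (mem_nbhd.1 hy))

theorem ServerOrder.card_nbhd (h : ServerOrder X Y ord) {x : M} (hx : x ∈ X) {j : ℕ}
    (hj : j ≤ Y.card) : (nbhd ord x j).card = j := by
  classical
  have h1 : (ord x).toFinset = Y := by ext; simp [h.mem x hx]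
  have h2 : (ord x).length = Y.card := by
    rw [← h1, List.toFinset_card_of_nodup (h.nodup x hx)]
  have h3 : nbhd ord x j = ((ord x).take j).toFinset := by ext; simp [mem_nbhd]
  rw [h3, List.toFinset_card_of_nodup ((List.take_sublist _ _).nodup (h.nodup x hx)),
    List.length_take, h2, min_eq_left hj]

theorem ServerOrder.dist_le (h : ServerOrder X Y ord) {x : M} (hx : x ∈ X) {j : ℕ} {y z : M}
    (hy : y ∈ nbhd ord x j) (hz : z ∈ Y) (hzj : z ∉ nbhd ord x j) : dist x y ≤ dist x z := by
  have h1 := h.sorted x hx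
  rw [← List.take_append_drop j (ord x), List.pairwise_append] at h1
  refine h1.2.2 y (mem_nbhd.1 hy) z ?_
  have h2 := (h.mem x hx z).2 hz
  rw [← List.take_append_drop j (ord x), List.mem_append] at h2
  exact h2.resolve_left fun h3 => hzj (mem_nbhd.2 h3)

end Neighbourhoods

/-! # Filtering the clients -/

section Filtering

variable {M : Type u}

/-- No client in `Xbar` threatens another one, and every other client threatens one of them. -/
structure ThreatFree (X : Finset M) (κ : M → ℕ) (ord : M → List M) (Xbar : Finset M) : Prop where
  subset : Xbar ⊆ X
  not_threatens : ∀ x ∈ Xbar, ∀ z ∈ Xbar, ¬ Threatens κ ord z x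
  threatens : ∀ z ∈ X, z ∉ Xbar → ∃ x ∈ Xbar, Threatens κ ord z x

/-- The state of the filtering after the clients in `D`. -/
structure FilterState (X : Finset M) (κ : M → ℕ) (ord : M → List M) (D : List M)
    (s : Finset M × Finset M) : Prop where
  kept_subset : ∀ x ∈ s.1, x ∈ D
  marked_subset : s.2 ⊆ X
  done : ∀ x ∈ D, x ∈ s.1 ∨ x ∈ s.2
  not_threatens : ∀ x ∈ s.1, ∀ z ∈ s.1, ¬ Threatens κ ord z x
  marked : ∀ z ∈ s.2, ∃ x ∈ s.1, Threatens κ ord z x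
  mark : ∀ x ∈ s.1, ∀ z ∈ X, Threatens κ ord z x → z ∈ s.2

theorem FilterState.skip {X : Finset M} {κ : M → ℕ} {ord : M → List M} {D : List M}
    {s : Finset M × Finset M} (h : FilterState X κ ord D s) {x : M} (hx : x ∈ s.2) :
    FilterState X κ ord (D ++ [x]) s where
  kept_subset z hz := by simp [h.kept_subset z hz]
  marked_subset := h.marked_subset
  done z hz := by
    rcases List.mem_append.1 hz with hz | hz
    · exact h.done z hz
    · obtain rfl : z = x := by simpa using hz
      exact .inr hx
  not_threatens := h.not_threatens
  marked := h.marked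
  mark := h.mark

-- Clients kept earlier have demand at least `κ x`, so they cannot threaten `x`; and had `x`
-- threatened one of them, it would be marked.
open Classical in
theorem FilterState.keep {X : Finset M} {κ : M → ℕ} {ord : M → List M} {D : List M}
    {s : Finset M × Finset M} (h : FilterState X κ ord D s) {x : M} (hxX : x ∈ X) (hx : x ∉ s.2)
    (hD : ∀ z ∈ D, κ x ≤ κ z) {T : Finset M} (hT : ∀ z, z ∈ T ↔ z ∈ X ∧ Threatens κ ord z x) :
    FilterState X κ ord (D ++ [x]) (insert x s.1, s.2 ∪ T) where
  kept_subset z hz := by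
    rcases Finset.mem_insert.1 hz with rfl | hz
    · simp
    · simp [h.kept_subset z hz]
  marked_subset := Finset.union_subset h.marked_subset fun z hz => ((hT z).1 hz).1
  done z hz := by
    rcases List.mem_append.1 hz with hz | hz
    · exact (h.done z hz).imp (Finset.mem_insert_of_mem) (Finset.mem_union_left _)
    · obtain rfl : z = x := by simpa using hz
      exact .inl (Finset.mem_insert_self _ _)
  not_threatens z hz w hw := by
    rcases Finset.mem_insert.1 hz with hz' | hz' <;> rcases Finset.mem_insert.1 hw with hw' | hw'
    · rw [hz', hw']
      exact fun ht => lt_irrefl _ ht.1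
    · rw [hz']
      exact fun ht => absurd (hD w (h.kept_subset w hw')) (not_le.2 ht.1)
    · rw [hw']
      exact fun ht => hx (h.mark z hz' x hxX ht)
    · exact h.not_threatens z hz' w hw'
  marked z hz := by
    rcases Finset.mem_union.1 hz with hz | hz
    · obtain ⟨w, hw, ht⟩ := h.marked z hz
      exact ⟨w, Finset.mem_insert_of_mem hw, ht⟩
    · exact ⟨x, Finset.mem_insert_self _ _, ((hT z).1 hz).2⟩
  mark z hz w hw ht := by
    rcases Finset.mem_insert.1 hz with rfl | hz
    · exact Finset.mem_union_right _ ((hT w).2 ⟨hw, ht⟩)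
    · exact Finset.mem_union_left _ (h.mark z hz w hw ht)

theorem meets_filterClients (X Y : Finset M) (κ : M → ℕ) (ord : M → List M) {n : ℕ}
    (hX : X.card ≤ n) (hY : Y.card ≤ n) :
    Meets (filterClients X Y κ ord) (50 * (n + 2) ^ 4) (ThreatFree X κ ord) := by
  classical
  refine (meets_sortBy (le := fun x x' => κ x' ≤ κ x) (fun _ _ => le_total _ _)
    (fun _ _ _ h h' => h'.trans h) X).bind (T₂ := 40 * (n + 2) ^ 4) (fun L hL => ?_) ?_
  swap
  · have : 8 * (X.card + 2) ^ 2 ≤ 8 * (n + 2) ^ 2 := by gcongr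
    refine (Nat.add_le_add_right this _).trans ?_
    ring_nf
    omega
  refine (meets_loop_of_le (N := n) (T := 20 * (n + 2) ^ 3) (FilterState X κ ord) (by omega)
    ⟨by simp, by simp, by simp, by simp, by simp, by simp⟩ ?_).bind (T₂ := 1)
    (fun s hs => Meets.steps le_rfl ?_) (by ring_nf; omega)
  · intro D x E s hD h
    have hs2 : s.2.card ≤ n := (Finset.card_le_card h.marked_subset).trans hX
    refine Meets.steps_bind (T₂ := 10 * (n + 2) ^ 3) ?_ (by ring_nf; omega)
    split_ifs with hx
    · exact Meets.steps (by ring_nf; omega) (h.skip hx)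
    · refine Meets.select_bind (T₂ := (n + 1) ^ 2)
        (fun T hT => Meets.steps (by gcongr) (h.keep ?_ hx (fun z hz => ?_) hT)) ?_
      · exact (hL.2.2.1 x).1 (by simp [hD])
      · have := hL.2.2.2
        rw [hD, List.pairwise_append] at this
        exact this.2.2 z hz x (by simp)
      · have : X.card * ((Y.card + 2) ^ 2 + 1) ≤ n * ((n + 2) ^ 2 + 1) := by gcongr
        refine (Nat.add_le_add_right (Nat.add_le_add_right this 1) _).trans ?_
        ring_nf
        omega
  · refine ⟨fun x hx => (hL.2.2.1 x).1 (hs.kept_subset x hx), hs.not_threatens,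
      fun z hz hz' => hs.marked z ?_⟩
    exact (hs.done z ((hL.2.2.1 z).2 hz)).resolve_left hz'

end Filtering

/-! # Hierarchies of nets -/

section Nets

variable {M : Type u} {κ : M → ℕ} {ord : M → List M}

/-- Hop distance at most one in the `i`-th graph. -/
def Near (κ : M → ℕ) (ord : M → List M) (i : ℕ) (x z : M) : Prop :=
  x = z ∨ Edge κ ord i x z

theorem Near.symm {i : ℕ} {x z : M} (h : Near κ ord i x z) : Near κ ord i z x :=
  h.imp Eq.symm fun h => ⟨h.2.1, h.1, fun h' => h.2.2 h'.symm⟩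

/-- The neighbourhoods shrink as the level grows, so the graphs lose edges. Hence a separated set
remains separated at higher levels, and a net can be extended to a net of the next level. -/
theorem Near.of_le {i j : ℕ} (hij : i ≤ j) {x z : M} (h : Near κ ord j x z) :
    Near κ ord i x z := by
  refine h.imp id fun h => ⟨hij.trans h.1, hij.trans h.2.1, fun hd => h.2.2 ?_⟩
  exact Finset.disjoint_of_subset_left (nbhd_mono x (by omega))
    (Finset.disjoint_of_subset_right (nbhd_mono z (by omega)) hd)

/-- The points of `N` have pairwise hop distance more than two in the `i`-th graph on `Xbar`. -/
structure Separated (κ : M → ℕ) (ord : M → List M) (Xbar : Finset M) (i : ℕ) (N : Finset M) :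
    Prop where
  subset : N ⊆ Xbar
  eq : ∀ x ∈ N, ∀ x' ∈ N, ∀ z ∈ Xbar, Near κ ord i x z → Near κ ord i z x' → x = x'

/-- A maximal set of points at pairwise hop distance more than two. -/
structure IsNet (κ : M → ℕ) (ord : M → List M) (Xbar : Finset M) (i : ℕ) (N : Finset M) : Prop
    extends Separated κ ord Xbar i N where
  dominates : ∀ x ∈ Xbar, ∃ x' ∈ N, ∃ z ∈ Xbar, Near κ ord i x z ∧ Near κ ord i z x'

theorem Separated.of_le {Xbar : Finset M} {i j : ℕ} (hij : i ≤ j) {N : Finset M}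
    (h : Separated κ ord Xbar i N) : Separated κ ord Xbar j N :=
  ⟨h.subset, fun x hx x' hx' z hz h1 h2 => h.eq x hx x' hx' z hz (h1.of_le hij) (h2.of_le hij)⟩

/-- `nb` lists the neighbours in the `i`-th graph on `Xbar`. -/
def IsAdjacency (κ : M → ℕ) (ord : M → List M) (Xbar : Finset M) (i : ℕ) (nb : M → Finset M) :
    Prop :=
  ∀ x ∈ Xbar, ∀ z, z ∈ nb x ↔ z ∈ Xbar ∧ z ≠ x ∧ Edge κ ord i x z

theorem meets_adjacency (Xbar Y : Finset M) (κ : M → ℕ) (ord : M → List M) (i : ℕ) {n : ℕ}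
    (hX : Xbar.card ≤ n) (hY : Y.card ≤ n) :
    Meets (adjacency Xbar Y κ ord i) (10 * (n + 2) ^ 4) (IsAdjacency κ ord Xbar i) := by
  classical
  refine (meets_enum Xbar).bind (T₂ := 8 * (n + 2) ^ 4) (fun L hL => ?_) (by ring_nf; omega)
  refine (meets_loop_of_le (N := n) (T := n * ((n + 2) ^ 2 + 1) + 1 + 1)
    (fun D nb => ∀ x ∈ D, ∀ z, z ∈ nb x ↔ z ∈ Xbar ∧ z ≠ x ∧ Edge κ ord i x z)
    (by omega) (by simp) ?_).weaken (by ring_nf; omega)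
    fun nb h x hx => h x ((hL.2.2 x).2 hx)
  intro D x E nb hD h
  refine Meets.select_bind (T₂ := 1) (fun S hS => Meets.steps le_rfl fun z hz => ?_)
    (by gcongr)
  by_cases hzx : z = x
  · subst hzx
    rw [Function.update_self]
    exact hS
  · rw [Function.update_of_ne hzx]
    exact h z (by simpa [hzx] using hz)

open Classical in
theorem mem_withinOne {Xbar : Finset M} {i : ℕ} {nb : M → Finset M}
    (hnb : IsAdjacency κ ord Xbar i nb) {S : Finset M} (hS : S ⊆ Xbar) {v : M} :
    v ∈ withinOne nb S ↔ v ∈ Xbar ∧ ∃ s ∈ S, Near κ ord i s v := by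
  rw [withinOne, Finset.mem_union, Finset.mem_biUnion]
  constructor
  · rintro (h | ⟨s, hs, h⟩)
    · exact ⟨hS h, v, h, .inl rfl⟩
    · rw [hnb s (hS hs)] at h
      exact ⟨h.1, s, hs, .inr h.2.2⟩
  · rintro ⟨hv, s, hs, h⟩
    by_cases hsv : s = v
    · exact .inl (hsv ▸ hs)
    · refine .inr ⟨s, hs, ?_⟩
      rw [hnb s (hS hs)]
      exact ⟨hv, Ne.symm hsv, h.resolve_left hsv⟩

theorem mem_withinTwo {Xbar : Finset M} {i : ℕ} {nb : M → Finset M}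
    (hnb : IsAdjacency κ ord Xbar i nb) {S : Finset M} (hS : S ⊆ Xbar) {v : M} :
    v ∈ withinOne nb (withinOne nb S) ↔
      v ∈ Xbar ∧ ∃ s ∈ S, ∃ z ∈ Xbar, Near κ ord i s z ∧ Near κ ord i z v := by
  rw [mem_withinOne hnb fun z hz => ((mem_withinOne hnb hS).1 hz).1]
  refine and_congr_right fun _ => ⟨?_, ?_⟩
  · rintro ⟨z, hz, hzv⟩
    obtain ⟨hz, s, hs, h⟩ := (mem_withinOne hnb hS).1 hz
    exact ⟨s, hs, z, hz, h, hzv⟩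
  · rintro ⟨s, hs, z, hz, h, hzv⟩
    exact ⟨z, (mem_withinOne hnb hS).2 ⟨hz, s, hs, h⟩, hzv⟩

open Classical in
theorem Separated.insert {Xbar : Finset M} {i : ℕ} {nb : M → Finset M}
    (hnb : IsAdjacency κ ord Xbar i nb) {N : Finset M} (h : Separated κ ord Xbar i N) {v : M}
    (hv : v ∈ Xbar) (hvN : v ∉ withinOne nb (withinOne nb N)) :
    Separated κ ord Xbar i (insert v N) := by
  rw [mem_withinTwo hnb h.subset] at hvN
  refine ⟨Finset.insert_subset hv h.subset, fun x hx x' hx' z hz h1 h2 => ?_⟩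
  rcases Finset.mem_insert.1 hx with hxv | hxN <;> rcases Finset.mem_insert.1 hx' with hxv' | hxN'
  · rw [hxv, hxv']
  · rw [hxv] at h1
    exact absurd ⟨hv, x', hxN', z, hz, h2.symm, h1.symm⟩ hvN
  · rw [hxv'] at h2
    exact absurd ⟨hv, x, hxN, z, hz, h1, h2⟩ hvN
  · exact h.eq x hxN x' hxN' z hz h1 h2

/-- As long as some vertex is unmarked, each round adds a new vertex. So after `Xbar.card` rounds
either everything is marked or the set is all of `Xbar`; it dominates in both cases. -/
theorem meets_growNet {Xbar : Finset M} {i : ℕ} {nb : M → Finset M}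
    (hnb : IsAdjacency κ ord Xbar i nb) {N : Finset M} (h : Separated κ ord Xbar i N) {n : ℕ}
    (hX : Xbar.card ≤ n) :
    Meets (growNet Xbar nb N) (10 * (n + 2) ^ 4) fun N' => IsNet κ ord Xbar i N' ∧ N ⊆ N' := by
  classical
  refine (meets_loop_of_le (N := n) (T := 4 * (n + 2) ^ 3)
    (fun D N' => Separated κ ord Xbar i N' ∧ N ⊆ N' ∧
      (Xbar ⊆ withinOne nb (withinOne nb N') ∨ D.length ≤ N'.card))
    (by simpa using hX) ⟨h, subset_rfl, by simp⟩ ?_).weaken (by ring_nf; omega) ?_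
  · rintro D a E N' - ⟨hN', hNN', hD⟩
    have h1 : 2 * (Xbar.card + 1) ^ 3 ≤ 2 * (n + 1) ^ 3 := by gcongr
    have h2 : Xbar.card * (Xbar.card + 1) ≤ n * (n + 1) := by gcongr
    refine Meets.steps_bind (T₂ := n * (n + 1) + 3) ?_ ((Nat.add_le_add_right h1 _).trans
      (by ring_nf; omega))
    refine Meets.select_bind (T₂ := 2) (fun U hU => ?_)
      (Nat.add_le_add_right (Nat.add_le_add_right h2 1) _)
    refine (meets_pick U).bind (T₂ := 1) (fun o ho => Meets.steps le_rfl ?_) le_rfl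
    rcases ho with ⟨hUe, rfl⟩ | ⟨v, hv, rfl⟩
    · refine ⟨by simpa using hN', by simpa using hNN', .inl fun v hv => ?_⟩
      by_contra hvN
      have := (hU v).2 ⟨hv, by simpa using hvN⟩
      simp [hUe] at this
    · have hv' := (hU v).1 hv
      have hins : N' ∪ (some v).toFinset = insert v N' := by
        ext; simp
      have hvN : v ∉ N' := fun hvN => hv'.2 <| (mem_withinTwo hnb hN'.subset).2
        ⟨hv'.1, v, hvN, v, hv'.1, .inl rfl, .inl rfl⟩
      have key : Separated κ ord Xbar i (insert v N') ∧ N ⊆ insert v N' ∧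
          (Xbar ⊆ withinOne nb (withinOne nb (insert v N')) ∨
            (D ++ [a]).length ≤ (insert v N').card) := by
        refine ⟨hN'.insert hnb hv'.1 hv'.2, hNN'.trans (Finset.subset_insert _ _), .inr ?_⟩
        rw [Finset.card_insert_of_notMem hvN, List.length_append, List.length_singleton]
        have := hD.resolve_left fun hsub => hv'.2 (hsub hv'.1)
        omega
      convert key
  · rintro N' ⟨hN', hNN', hD⟩
    refine ⟨⟨hN', fun x hx => ?_⟩, hNN'⟩
    rcases hD with hD | hD
    · obtain ⟨-, s, hs, z, hz, h1, h2⟩ := (mem_withinTwo hnb hN'.subset).1 (hD hx)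
      exact ⟨s, hs, z, hz, h2.symm, h1.symm⟩
    · rw [List.length_range] at hD
      have := Finset.eq_of_subset_of_card_le hN'.subset hD
      exact ⟨x, this ▸ hx, x, hx, .inl rfl, .inl rfl⟩

/-- The sets `net 1 ⊆ net 2 ⊆ … ⊆ net k` are nets. -/
structure IsHierarchy (κ : M → ℕ) (ord : M → List M) (Xbar : Finset M) (k : ℕ)
    (net : ℕ → Finset M) : Prop where
  zero : net 0 = ∅
  isNet : ∀ i, 1 ≤ i → i ≤ k → IsNet κ ord Xbar i (net i)
  subset : ∀ i, 1 ≤ i → i ≤ k → net (i - 1) ⊆ net i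

theorem IsHierarchy.mono {Xbar : Finset M} {k : ℕ} {net : ℕ → Finset M}
    (h : IsHierarchy κ ord Xbar k net) {i j : ℕ} (hij : i ≤ j) (hj : j ≤ k) : net i ⊆ net j := by
  induction j, hij using Nat.le_induction with
  | base => exact subset_rfl
  | succ j hij ih => exact (ih (by omega)).trans (h.subset (j + 1) (by omega) hj)

theorem meets_netHierarchy (Xbar Y : Finset M) (κ : M → ℕ) (ord : M → List M) (k : ℕ) {n : ℕ}
    (hX : Xbar.card ≤ n) (hY : Y.card ≤ n) (hk : k ≤ n) :
    Meets (netHierarchy Xbar Y κ ord k) (30 * (n + 2) ^ 5) (IsHierarchy κ ord Xbar k) := by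
  classical
  refine (meets_loop_range' (T := 21 * (n + 2) ^ 4)
    (fun i => IsHierarchy κ ord Xbar (i - 1)) ⟨rfl, by omega, by omega⟩ ?_).weaken ?_ ?_
  · intro i net hi hik h
    refine (meets_adjacency Xbar Y κ ord i hX hY).bind (T₂ := 11 * (n + 2) ^ 4)
      (fun nb hnb => ?_) (by ring_nf; omega)
    have hsep : Separated κ ord Xbar i (net (i - 1)) := by
      rcases Nat.lt_or_ge 1 i with hi' | hi'
      · exact (h.isNet (i - 1) (by omega) le_rfl).toSeparated.of_le (by omega)
      · obtain rfl : i = 1 := by omega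
        rw [show (1 - 1 : ℕ) = 0 from rfl, h.zero]
        exact ⟨by simp, by simp⟩
    refine (meets_growNet hnb hsep hX).bind (T₂ := 1) (fun N hN => Meets.steps le_rfl ?_)
      (by ring_nf; omega)
    have hne : ∀ j, j < i → Function.update net i N j = net j := fun j hj =>
      Function.update_of_ne (by omega) _ _
    refine ⟨?_, fun j hj hji => ?_, fun j hj hji => ?_⟩
    · rw [hne 0 (by omega)]
      exact h.zero
    · rcases Nat.lt_or_ge j i with hj' | hj'
      · rw [hne j hj']
        exact h.isNet j hj (by omega)
      · obtain rfl : j = i := by omega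
        rw [Function.update_self]
        exact hN.1
    · rw [hne (j - 1) (by omega)]
      rcases Nat.lt_or_ge j i with hj' | hj'
      · rw [hne j hj']
        exact h.subset j hj (by omega)
      · obtain rfl : j = i := by omega
        rw [Function.update_self]
        exact hN.2
  · have : k * (21 * (n + 2) ^ 4 + 1) ≤ n * (21 * (n + 2) ^ 4 + 1) := by gcongr
    refine (Nat.add_le_add_right this 1).trans ?_
    ring_nf
    omega
  · intro net h
    exact h

end Nets

/-! # Partitioning the servers -/

section Partition

variable {M : Type u}

/-- The server subsets are pairwise disjoint and consist of unavailable servers. -/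
structure Subsets.Valid (Y : Finset M) (s : Subsets M) : Prop where
  avail_subset : s.avail ⊆ Y
  shared_subset : ∀ i, s.shared i ⊆ Y
  priv_subset : ∀ i, s.priv i ⊆ Y
  shared_avail : ∀ i, Disjoint (s.shared i) s.avail
  priv_avail : ∀ i, Disjoint (s.priv i) s.avail
  shared_shared : ∀ i j, i ≠ j → Disjoint (s.shared i) (s.shared j)
  priv_priv : ∀ i j, i ≠ j → Disjoint (s.priv i) (s.priv j)
  shared_priv : ∀ i j, Disjoint (s.shared i) (s.priv j)

open Classical in
noncomputable def Subsets.moveShared (s : Subsets M) (i : ℕ) (y : M) : Subsets M :=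
  { s with avail := s.avail \ {y}, shared := Function.update s.shared i (s.shared i ∪ {y}) }

open Classical in
noncomputable def Subsets.movePriv (s : Subsets M) (i : ℕ) (y : M) : Subsets M :=
  { s with avail := s.avail \ {y}, priv := Function.update s.priv i (s.priv i ∪ {y}) }

variable {Y : Finset M} {s : Subsets M} {i : ℕ} {y : M}

theorem mem_update_union_singleton [DecidableEq M] {f : ℕ → Finset M} {j : ℕ} {z : M} :
    z ∈ Function.update f i (f i ∪ {y}) j ↔ z ∈ f j ∨ j = i ∧ z = y := by
  by_cases h : j = i
  · subst h
    simp [or_comm]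
  · simp [h]

theorem disjoint_update_union_singleton [DecidableEq M] {f : ℕ → Finset M} {j : ℕ} {S : Finset M}
    (h : Disjoint (f j) S) (hy : y ∉ S) :
    Disjoint (Function.update f i (f i ∪ {y}) j) S := by
  rw [Finset.disjoint_left] at *
  intro z hz
  rcases mem_update_union_singleton.1 hz with hz | ⟨-, rfl⟩
  · exact h hz
  · exact hy

theorem Subsets.Valid.moveShared (h : s.Valid Y) (hy : y ∈ s.avail) :
    (s.moveShared i y).Valid Y := by
  classical
  have hd : ∀ j, y ∉ s.shared j := fun j hj => Finset.disjoint_left.1 (h.shared_avail j) hj hy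
  have hp : ∀ j, y ∉ s.priv j := fun j hj => Finset.disjoint_left.1 (h.priv_avail j) hj hy
  refine ⟨Finset.sdiff_subset.trans h.avail_subset, fun j z hz => ?_, h.priv_subset,
    fun j => ?_, fun j => Finset.disjoint_of_subset_right Finset.sdiff_subset (h.priv_avail j),
    fun j j' hjj' => ?_, h.priv_priv, fun j j' => ?_⟩
  · rcases mem_update_union_singleton.1 hz with hz | ⟨-, rfl⟩
    · exact h.shared_subset j hz
    · exact h.avail_subset hy
  · exact disjoint_update_union_singleton
      (Finset.disjoint_of_subset_right Finset.sdiff_subset (h.shared_avail j))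
      (Finset.notMem_sdiff_of_mem_right (Finset.mem_singleton_self y))
  · rw [Finset.disjoint_left]
    intro z hz hz'
    rcases mem_update_union_singleton.1 hz with hzj | ⟨rfl, rfl⟩ <;>
      rcases mem_update_union_singleton.1 hz' with hzj' | ⟨rfl, h'⟩
    · exact Finset.disjoint_left.1 (h.shared_shared j j' hjj') hzj hzj'
    · exact hd j (h' ▸ hzj)
    · exact hd j' hzj'
    · exact hjj' rfl
  · exact disjoint_update_union_singleton (h.shared_priv j j') (hp j')

theorem Subsets.Valid.movePriv (h : s.Valid Y) (hy : y ∈ s.avail) :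
    (s.movePriv i y).Valid Y := by
  classical
  have hd : ∀ j, y ∉ s.shared j := fun j hj => Finset.disjoint_left.1 (h.shared_avail j) hj hy
  have hp : ∀ j, y ∉ s.priv j := fun j hj => Finset.disjoint_left.1 (h.priv_avail j) hj hy
  refine ⟨Finset.sdiff_subset.trans h.avail_subset, h.shared_subset, fun j z hz => ?_,
    fun j => Finset.disjoint_of_subset_right Finset.sdiff_subset (h.shared_avail j),
    fun j => ?_, h.shared_shared, fun j j' hjj' => ?_, fun j j' => ?_⟩
  · rcases mem_update_union_singleton.1 hz with hz | ⟨-, rfl⟩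
    · exact h.priv_subset j hz
    · exact h.avail_subset hy
  · exact disjoint_update_union_singleton
      (Finset.disjoint_of_subset_right Finset.sdiff_subset (h.priv_avail j))
      (Finset.notMem_sdiff_of_mem_right (Finset.mem_singleton_self y))
  · rw [Finset.disjoint_left]
    intro z hz hz'
    rcases mem_update_union_singleton.1 hz with hzj | ⟨rfl, rfl⟩ <;>
      rcases mem_update_union_singleton.1 hz' with hzj' | ⟨rfl, h'⟩
    · exact Finset.disjoint_left.1 (h.priv_priv j j' hjj') hzj hzj'
    · exact hp j (h' ▸ hzj)
    · exact hp j' hzj'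
    · exact hjj' rfl
  · exact (disjoint_update_union_singleton (h.shared_priv j j').symm (hd j)).symm

theorem mem_take_of_getLast?_filter {ι : Type u} {p : ι → Bool} {l : List ι} (hl : l.Nodup)
    {m n : ℕ} {y z : ι} (hy : ((l.take m).filter p).getLast? = some y) (hyn : y ∈ l.take n)
    (hz : z ∈ l.take m) (hpz : p z) : z ∈ l.take n := by
  have hsplit := List.take_append_drop n (l.take m)
  rw [List.take_take] at hsplit
  rw [← hsplit, List.mem_append] at hz
  rcases hz with hz | hz
  · exact List.take_subset_take_left _ (min_le_left _ _) hz
  · exfalso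
    -- If `z` came after the first `n` entries, the last entry passing the test would also come from
    -- there, and `y` would occur twice in `l`.
    rw [← hsplit, List.filter_append, List.getLast?_append_of_ne_nil] at hy
    swap
    · exact List.ne_nil_of_mem (List.mem_filter.2 ⟨hz, hpz⟩)
    have hy' := List.mem_of_mem_filter (List.mem_of_getLast? hy)
    have hy'' : y ∈ l.drop n := by
      rw [List.drop_take] at hy'
      exact List.mem_of_mem_take hy'
    rw [← List.take_append_drop n l] at hl
    exact (List.nodup_append.1 hl).2.2 y hyn y hy'' rfl

variable {κ : M → ℕ} {ord : M → List M} {x : M}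

theorem meets_takeShared (hord : (ord x).Nodup) (hi : 2 * i ≤ κ x) {z : M}
    (hz : z ∈ nbhd ord x (κ x - (i - 1))) (hzs : z ∈ s.avail) {n : ℕ} (hY : Y.card ≤ n) :
    Meets (takeShared Y κ ord i x s) (2 * (n + 2) ^ 2) fun s' => ∃ y, s' = s.moveShared i y ∧
      y ∈ nbhd ord x (κ x - (i - 1)) ∧ y ∈ s.avail ∧
      ∀ m, y ∈ nbhd ord x m → ∀ z ∈ nbhd ord x (κ x - (i - 1)), z ∈ s.avail →
        z ∈ nbhd ord x m := by
  classical
  rw [takeShared, if_pos hi]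
  have h1 : (Y.card + 2) ^ 2 ≤ (n + 2) ^ 2 := by gcongr
  refine Meets.steps_bind (T₂ := 2 * n + 1) ?_
    ((Nat.add_le_add_right h1 _).trans (by ring_nf; omega))
  refine Meets.steps (by omega) ?_
  generalize hl : List.filter _ ((ord x).take (κ x - (i - 1))) = l
  have hzl : z ∈ l := by
    rw [← hl, List.mem_filter]
    exact ⟨mem_nbhd.1 hz, by simpa using hzs⟩
  obtain ⟨y, hy⟩ : ∃ y, l.getLast? = some y :=
    ⟨_, List.getLast?_eq_some_getLast (List.ne_nil_of_mem hzl)⟩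
  have hyl := List.mem_of_getLast? hy
  rw [← hl, List.mem_filter] at hyl
  refine ⟨y, ?_, mem_nbhd.2 hyl.1, by simpa using hyl.2, fun m hm w hw hws => ?_⟩
  · simp [Subsets.moveShared, hy]
  · rw [← hl] at hy
    rw [mem_nbhd] at *
    exact mem_take_of_getLast?_filter hord hy hm hw (by simpa using hws)

theorem meets_takePrivate (hi : 2 * i - 1 ≤ κ x) {z : M}
    (hz : z ∈ nbhd ord x ((κ x + 1) / 2)) (hzs : z ∈ s.avail) {n : ℕ} (hY : Y.card ≤ n) :
    Meets (takePrivate Y κ ord i x s) (2 * (n + 2) ^ 2) fun s' => ∃ y, s' = s.movePriv i y ∧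
      y ∈ nbhd ord x ((κ x + 1) / 2) ∧ y ∈ s.avail := by
  classical
  rw [takePrivate, if_pos hi]
  have h1 : (Y.card + 2) ^ 2 ≤ (n + 2) ^ 2 := by gcongr
  refine Meets.steps_bind (T₂ := 2 * n + 2) ?_
    ((Nat.add_le_add_right h1 _).trans (by ring_nf; omega))
  refine (meets_pick _).bind (T₂ := 2 * n + 1) (fun o ho => Meets.steps (by omega) ?_) (by omega)
  rcases ho with ⟨he, -⟩ | ⟨y, hy, rfl⟩
  · have := Finset.mem_inter.2 ⟨hz, hzs⟩
    simp [he] at this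
  · rw [Finset.mem_inter] at hy
    exact ⟨y, by simp [Subsets.movePriv], hy⟩

/-! ### Bookkeeping within one round. -/

/-- The servers moved so far in round `i`, which started with available servers `A`: the clients in
`D` have got the shared servers `sh` and those in `E` the private servers `pr`. -/
structure Picks (κ : M → ℕ) (ord : M → List M) (i : ℕ) (A : Finset M) (D E : List M)
    (sh pr : M → M) (s : Subsets M) : Prop where
  avail_subset : s.avail ⊆ A
  taken : ∀ y ∈ A, y ∉ s.avail → (∃ x ∈ D, 2 * i ≤ κ x ∧ y = sh x) ∨
    ∃ x ∈ E, 2 * i - 1 ≤ κ x ∧ y = pr x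
  sh_mem : ∀ x ∈ D, 2 * i ≤ κ x → sh x ∈ s.shared i
  sh_nbhd : ∀ x ∈ D, 2 * i ≤ κ x → sh x ∈ nbhd ord x (κ x - (i - 1))
  sh_last : ∀ x ∈ D, 2 * i ≤ κ x → ∀ m, sh x ∈ nbhd ord x m →
    ∀ z ∈ nbhd ord x (κ x - (i - 1)), z ∈ A → z ∈ nbhd ord x m
  pr_mem : ∀ x ∈ E, 2 * i - 1 ≤ κ x → pr x ∈ s.priv i
  pr_nbhd : ∀ x ∈ E, 2 * i - 1 ≤ κ x → pr x ∈ nbhd ord x ((κ x + 1) / 2)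

variable {A : Finset M} {D E : List M} {sh pr : M → M}

theorem Picks.skipShared (h : Picks κ ord i A D E sh pr s) (hi : κ x < 2 * i) :
    Picks κ ord i A (D ++ [x]) E sh pr s := by
  have key : ∀ z ∈ D ++ [x], 2 * i ≤ κ z → z ∈ D := fun z hz hzi => by
    rcases List.mem_append.1 hz with hz | hz
    · exact hz
    · obtain rfl : z = x := by simpa using hz
      omega
  exact ⟨h.avail_subset, fun y hy hys => (h.taken y hy hys).imp_left fun ⟨z, hz, h⟩ =>
      ⟨z, by simp [hz], h⟩, fun z hz hzi => h.sh_mem z (key z hz hzi) hzi,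
    fun z hz hzi => h.sh_nbhd z (key z hz hzi) hzi,
    fun z hz hzi => h.sh_last z (key z hz hzi) hzi, h.pr_mem, h.pr_nbhd⟩

theorem Picks.skipPriv (h : Picks κ ord i A D E sh pr s) (hi : κ x < 2 * i - 1) :
    Picks κ ord i A D (E ++ [x]) sh pr s := by
  have key : ∀ z ∈ E ++ [x], 2 * i - 1 ≤ κ z → z ∈ E := fun z hz hzi => by
    rcases List.mem_append.1 hz with hz | hz
    · exact hz
    · obtain rfl : z = x := by simpa using hz
      omega
  exact ⟨h.avail_subset, fun y hy hys => (h.taken y hy hys).imp_right fun ⟨z, hz, h⟩ =>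
      ⟨z, by simp [hz], h⟩, h.sh_mem, h.sh_nbhd, h.sh_last,
    fun z hz hzi => h.pr_mem z (key z hz hzi) hzi,
    fun z hz hzi => h.pr_nbhd z (key z hz hzi) hzi⟩

open Classical in
theorem Picks.moveShared (h : Picks κ ord i A D E sh pr s) (hx : x ∉ D) (hi : 2 * i ≤ κ x)
    (hy : y ∈ nbhd ord x (κ x - (i - 1)))
    (hlast : ∀ m, y ∈ nbhd ord x m → ∀ z ∈ nbhd ord x (κ x - (i - 1)), z ∈ A → z ∈ nbhd ord x m) :
    Picks κ ord i A (D ++ [x]) E (Function.update sh x y) pr (s.moveShared i y) := by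
  have hne : ∀ z ∈ D, Function.update sh x y z = sh z := fun z hz =>
    Function.update_of_ne (by rintro rfl; exact hx hz) _ _
  have key : ∀ z ∈ D ++ [x], z ∈ D ∨ z = x := fun z hz => by simpa using hz
  refine ⟨Finset.sdiff_subset.trans h.avail_subset, fun w hw hws => ?_, fun z hz hzi => ?_,
    fun z hz hzi => ?_, fun z hz hzi => ?_, h.pr_mem, h.pr_nbhd⟩
  · by_cases hwy : w = y
    · exact .inl ⟨x, by simp, hi, by simp [hwy]⟩
    · have : w ∉ s.avail := fun hw' => hws (Finset.mem_sdiff.2 ⟨hw', by simpa using hwy⟩)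
      refine (h.taken w hw this).imp_left fun ⟨z, hz, hzi, hwz⟩ => ⟨z, by simp [hz], hzi, ?_⟩
      rw [hne z hz, hwz]
  · refine mem_update_union_singleton.2 ?_
    rcases key z hz with hz | rfl
    · rw [hne z hz]
      exact .inl (h.sh_mem z hz hzi)
    · exact .inr ⟨rfl, by simp⟩
  · rcases key z hz with hz | rfl
    · rw [hne z hz]
      exact h.sh_nbhd z hz hzi
    · rwa [Function.update_self]
  · rcases key z hz with hz | rfl
    · rw [hne z hz]
      exact h.sh_last z hz hzi
    · rwa [Function.update_self]

open Classical in
theorem Picks.movePriv (h : Picks κ ord i A D E sh pr s) (hx : x ∉ E) (hi : 2 * i - 1 ≤ κ x)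
    (hy : y ∈ nbhd ord x ((κ x + 1) / 2)) :
    Picks κ ord i A D (E ++ [x]) sh (Function.update pr x y) (s.movePriv i y) := by
  have hne : ∀ z ∈ E, Function.update pr x y z = pr z := fun z hz =>
    Function.update_of_ne (by rintro rfl; exact hx hz) _ _
  have key : ∀ z ∈ E ++ [x], z ∈ E ∨ z = x := fun z hz => by simpa using hz
  refine ⟨Finset.sdiff_subset.trans h.avail_subset, fun w hw hws => ?_, h.sh_mem, h.sh_nbhd,
    h.sh_last, fun z hz hzi => ?_, fun z hz hzi => ?_⟩
  · by_cases hwy : w = y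
    · exact .inr ⟨x, by simp, hi, by simp [hwy]⟩
    · have : w ∉ s.avail := fun hw' => hws (Finset.mem_sdiff.2 ⟨hw', by simpa using hwy⟩)
      refine (h.taken w hw this).imp_right fun ⟨z, hz, hzi, hwz⟩ => ⟨z, by simp [hz], hzi, ?_⟩
      rw [hne z hz, hwz]
  · refine mem_update_union_singleton.2 ?_
    rcases key z hz with hz | rfl
    · rw [hne z hz]
      exact .inl (h.pr_mem z hz hzi)
    · exact .inr ⟨rfl, by simp⟩
  · rcases key z hz with hz | rfl
    · rw [hne z hz]
      exact h.pr_nbhd z hz hzi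
    · rwa [Function.update_self]

/-- A server that was moved in round `i` comes from a client whose neighbourhood contains it. -/
theorem Picks.exists_owner (h : Picks κ ord i A D E sh pr s) (hi : 1 ≤ i) (hy : y ∈ A)
    (hys : y ∉ s.avail) : ∃ x, 2 * i - 1 ≤ κ x ∧ y ∈ nbhd ord x (κ x - (i - 1)) ∧
      (x ∈ D ∧ 2 * i ≤ κ x ∧ y = sh x ∨ x ∈ E ∧ y = pr x) := by
  rcases h.taken y hy hys with ⟨x, hx, hxi, rfl⟩ | ⟨x, hx, hxi, rfl⟩
  · exact ⟨x, by omega, h.sh_nbhd x hx hxi, .inl ⟨hx, hxi, rfl⟩⟩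
  · exact ⟨x, hxi, nbhd_mono x (by omega) (h.pr_nbhd x hx hxi), .inr ⟨hx, rfl⟩⟩

theorem edge_of_mem {x x' : M} (hx : 2 * i - 1 ≤ κ x) (hx' : 2 * i - 1 ≤ κ x')
    (hy : y ∈ nbhd ord x (κ x - (i - 1))) (hy' : y ∈ nbhd ord x' (κ x' - (i - 1))) :
    Near κ ord i x x' :=
  .inr ⟨by omega, by omega, fun h => Finset.disjoint_left.1 h hy hy'⟩

variable {Xbar N : Finset M}

/-- Two clients of the net with a common server at level `i` are at hop distance at most one, hence
equal. So in round `i` only `x` itself takes servers from its neighbourhood. -/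
theorem Picks.owner_eq (h : Picks κ ord i A D E sh pr s) (hi : 1 ≤ i)
    (hN : Separated κ ord Xbar i N) (hD : ∀ z ∈ D, z ∈ N) (hE : ∀ z ∈ E, z ∈ N) (hx : x ∈ N)
    (hxi : 2 * i - 1 ≤ κ x) (hy : y ∈ nbhd ord x (κ x - (i - 1))) (hyA : y ∈ A)
    (hys : y ∉ s.avail) : x ∈ D ∧ 2 * i ≤ κ x ∧ y = sh x ∨ x ∈ E ∧ y = pr x := by
  obtain ⟨z, hzi, hyz, hz⟩ := h.exists_owner hi hyA hys
  have hzN : z ∈ N := by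
    rcases hz with hz | hz
    · exact hD z hz.1
    · exact hE z hz.1
  obtain rfl := hN.eq x hx z hzN z (hN.subset hzN) (edge_of_mem hxi hzi hy hyz) (.inl rfl)
  exact hz

/-! ### The loss bound and its preservation. -/

/-- At the beginning of round `i`, few servers have been taken from the neighbourhoods of
the clients that still need servers. -/
def Plenty (κ : M → ℕ) (ord : M → List M) (k : ℕ) (net : ℕ → Finset M) (i : ℕ) (A : Finset M) :
    Prop :=
  ∀ j, i ≤ j → j ≤ k → ∀ x ∈ net j, 2 * j - 1 ≤ κ x →
    ∀ S ⊆ nbhd ord x (κ x - (j - 1)), Disjoint S A → S.card ≤ i - 1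

variable [MetricSpace M] {X : Finset M} {k : ℕ} {net : ℕ → Finset M}

/-- Of the `κ x - (i - 1)` nearest servers at most `i - 1` are gone. At least one is left, and at
least two if `2 * i ≤ κ x`. -/
theorem Plenty.le_card (h : Plenty κ ord k net i A) (hord : ServerOrder X Y ord) (hx : x ∈ X)
    (hκ : κ x ≤ Y.card) (hik : i ≤ k) (hxN : x ∈ net i) (hxi : 2 * i - 1 ≤ κ x) [DecidableEq M] :
    κ x ≤ (nbhd ord x (κ x - (i - 1)) ∩ A).card + 2 * (i - 1) := by
  have h1 := h i le_rfl hik x hxN hxi (nbhd ord x (κ x - (i - 1)) \ A) Finset.sdiff_subset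
    Finset.sdiff_disjoint
  have h2 := Finset.card_sdiff_add_card_inter (nbhd ord x (κ x - (i - 1))) A
  rw [hord.card_nbhd hx (by omega)] at h2
  omega

/-- After the choice of a shared server there is a private server left. -/
theorem Picks.exists_private (h : Picks κ ord i A (D ++ [x]) D sh pr s) (hi : 1 ≤ i)
    (hord : ServerOrder X Y ord) (hN : Separated κ ord Xbar i (net i))
    (hD : ∀ z ∈ D, z ∈ net i) (hxD : x ∉ D) (hA : Plenty κ ord k net i A) (hx : x ∈ X)
    (hκ : κ x ≤ Y.card) (hik : i ≤ k) (hxN : x ∈ net i) (hxi : 2 * i - 1 ≤ κ x) :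
    ∃ y ∈ nbhd ord x ((κ x + 1) / 2), y ∈ s.avail := by
  classical
  by_contra! hcon
  have hsub : nbhd ord x ((κ x + 1) / 2) ⊆ nbhd ord x (κ x - (i - 1)) := nbhd_mono x (by omega)
  have hD' : ∀ z ∈ D ++ [x], z ∈ net i := fun z hz => by
    rcases List.mem_append.1 hz with hz | hz
    · exact hD z hz
    · obtain rfl : z = x := by simpa using hz
      exact hxN
  -- A private server that disappeared in this round was taken by `x`, which so far has only made
  -- its shared pick.
  have key : ∀ y ∈ nbhd ord x ((κ x + 1) / 2), y ∈ A → 2 * i ≤ κ x ∧ y = sh x := by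
    intro y hy hyA
    rcases h.owner_eq hi hN hD' hD hxN hxi (hsub hy) hyA (hcon y hy) with h' | h'
    · exact h'.2
    · exact absurd h'.1 hxD
  -- If the farthest available server is already a private one, all available servers of the
  -- neighbourhood are private; there are at least two, but `key` allows only `sh x`. Otherwise all
  -- of the at least `i` private servers were lost in earlier rounds, against the bound `i - 1`.
  by_cases hsh : 2 * i ≤ κ x ∧ sh x ∈ nbhd ord x ((κ x + 1) / 2)
  · have hle := hA.le_card hord hx hκ hik hxN hxi
    have : nbhd ord x (κ x - (i - 1)) ∩ A ⊆ {sh x} := fun z hz => by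
      rw [Finset.mem_inter] at hz
      have := h.sh_last x (by simp) hsh.1 _ hsh.2 z hz.1 hz.2
      simpa using (key z this hz.2).2
    have := Finset.card_le_card this
    rw [Finset.card_singleton] at this
    omega
  · have hdisj : Disjoint (nbhd ord x ((κ x + 1) / 2)) A := Finset.disjoint_left.2
      fun y hy hyA => hsh ⟨(key y hy hyA).1, (key y hy hyA).2 ▸ hy⟩
    have := hA i le_rfl hik x hxN hxi _ hsub hdisj
    rw [hord.card_nbhd hx (by omega)] at this
    omega

theorem Picks.plenty_succ (h : Picks κ ord i A D D sh pr s) (hi : 1 ≤ i)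
    (hord : ServerOrder X Y ord) (hκ : ∀ x ∈ X, κ x ≤ Y.card) (hT : ThreatFree X κ ord Xbar)
    (hnet : IsHierarchy κ ord Xbar k net) (hD : ∀ z, z ∈ D ↔ z ∈ net i)
    (hA : Plenty κ ord k net i A) : Plenty κ ord k net (i + 1) s.avail := by
  classical
  intro j hij hjk x hxj hxκ S hS hSd
  have hxX : x ∈ X := hT.subset ((hnet.isNet j (by omega) hjk).subset hxj)
  have hsep := (hnet.isNet i hi (by omega)).toSeparated
  have hsepj := (hnet.isNet j (by omega) hjk).toSeparated
  have hijnet := hnet.mono (i := i) (j := j) (by omega) hjk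
  have hSi : S ⊆ nbhd ord x (κ x - (i - 1)) := hS.trans (nbhd_mono x (by omega))
  -- `S \ A` was lost in earlier rounds, `S ∩ A` in round `i`. The total must be at most `i`.
  have hcard : S.card = (S \ A).card + (S ∩ A).card :=
    (Finset.card_sdiff_add_card_inter S A).symm
  by_cases hxi : x ∈ net i
  · have hSA : S ∩ A ⊆ {sh x, pr x} := fun y hy => by
      rw [Finset.mem_inter] at hy
      have := h.owner_eq hi hsep (fun z hz => (hD z).1 hz) (fun z hz => (hD z).1 hz) hxi
        (by omega) (hSi hy.1) hy.2 (Finset.disjoint_left.1 hSd hy.1)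
      rw [Finset.mem_insert, Finset.mem_singleton]
      exact this.imp (fun h => h.2.2) fun h => h.2
    -- If so, no server of the larger neighbourhood available at the start of the round lies outside
    -- `nbhd ord x (κ x - i)`. The smaller neighbourhood thus has the same available servers but one
    -- element less, so its earlier losses are at most `i - 2`, which leaves room for the two picks
    -- of `x`. If not, only `pr x` is a new loss.
    by_cases hsh : sh x ∈ nbhd ord x (κ x - i)
    · have h1 := h.sh_last x ((hD x).2 hxi) (by omega) _ hsh
      have h2 := hA.le_card hord hxX (hκ x hxX) (by omega) hxi (by omega)
      have h3 : nbhd ord x (κ x - (i - 1)) ∩ A ⊆ nbhd ord x (κ x - i) ∩ A := fun z hz => by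
        rw [Finset.mem_inter] at *
        exact ⟨h1 z hz.1 hz.2, hz.2⟩
      have h4 := Finset.card_le_card h3
      have h5 := Finset.card_sdiff_add_card_inter (nbhd ord x (κ x - i)) A
      rw [hord.card_nbhd hxX ((Nat.sub_le _ _).trans (hκ x hxX))] at h5
      have h6 : (S \ A).card ≤ (nbhd ord x (κ x - i) \ A).card := Finset.card_le_card
        (Finset.sdiff_subset_sdiff (hS.trans (nbhd_mono x (by omega))) subset_rfl)
      have h7 := (Finset.card_le_card hSA).trans Finset.card_le_two
      omega
    · have h1 : S ∩ A ⊆ {pr x} := fun y hy => by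
        have h' := hSA hy
        rw [Finset.mem_insert, Finset.mem_singleton] at h'
        rw [Finset.mem_singleton]
        refine h'.resolve_left fun h' => hsh ?_
        rw [← h']
        exact nbhd_mono x (by omega) (hS (Finset.mem_inter.1 hy).1)
      have h2 := Finset.card_le_card h1
      rw [Finset.card_singleton] at h2
      have h3 := hA i le_rfl (by omega) x hxi (by omega) (S \ A) (Finset.sdiff_subset.trans hSi)
        Finset.sdiff_disjoint
      omega
  · have h1 := hA j (by omega) hjk x hxj hxκ (S \ A) (Finset.sdiff_subset.trans hS)
      Finset.sdiff_disjoint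
    -- A client outside `net i` loses only shared picks in this round.
    have key : ∀ y ∈ S ∩ A, ∃ z ∈ net i, Near κ ord i x z ∧ y = sh z := by
      intro y hy
      rw [Finset.mem_inter] at hy
      obtain ⟨z, hzi, hyz, hz⟩ := h.exists_owner hi hy.2 (Finset.disjoint_left.1 hSd hy.1)
      have hzN : z ∈ net i := by
        rcases hz with hz | hz
        · exact (hD z).1 hz.1
        · exact (hD z).1 hz.1
      refine ⟨z, hzN, edge_of_mem (by omega) hzi (hSi hy.1) hyz, ?_⟩
      rcases hz with hz | hz
      · exact hz.2.2
      exfalso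
      have hpr := h.pr_nbhd z hz.1 hzi
      rw [← hz.2] at hpr
      -- A private pick of `z` lies among its nearest `⌈κ z / 2⌉` servers. If `κ z ≥ 2 * j - 1`,
      -- these belong to its neighbourhood of level `j`, so separation in `net j` gives `x = z`,
      -- although `x ∉ net i`. If `κ z` is smaller, then `κ z / 2 ≤ j - 1` and the common server
      -- makes `z` threaten `x`.
      by_cases hzj : 2 * j - 1 ≤ κ z
      · have := hsepj.eq x hxj z (hijnet hzN) z (hsepj.subset (hijnet hzN))
          (edge_of_mem hxκ hzj (hS hy.1) (nbhd_mono z (by omega) hpr)) (.inl rfl)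
        exact hxi (this ▸ hzN)
      · refine hT.not_threatens x (hsepj.subset hxj) z (hsepj.subset (hijnet hzN))
          ⟨by omega, fun hd => ?_⟩
        exact Finset.disjoint_left.1 hd (nbhd_mono x (by omega) (hS hy.1))
          (nbhd_mono z (by omega) hpr)
    -- Two such owners would be at hop distance at most two through `x`.
    have h2 : (S ∩ A).card ≤ 1 := Finset.card_le_one.2 fun y hy y' hy' => by
      obtain ⟨z, hz, hxz, rfl⟩ := key y hy
      obtain ⟨z', hz', hxz', rfl⟩ := key y' hy'
      rw [hsep.eq z hz z' hz' x (hsepj.subset hxj) hxz.symm hxz']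
    omega

/-- The clients of the net of level `j` have servers in the `j`-th subsets, for all `j < i`. -/
def Served (κ : M → ℕ) (ord : M → List M) (net : ℕ → Finset M) (i : ℕ) (s : Subsets M) : Prop :=
  ∀ j, 1 ≤ j → j < i → ∀ x ∈ net j,
    (2 * j ≤ κ x → ∃ y ∈ s.shared j, y ∈ nbhd ord x (κ x - (j - 1))) ∧
    (2 * j - 1 ≤ κ x → ∃ y ∈ s.priv j, y ∈ nbhd ord x (κ x - (j - 1)))

/-- The state in round `i` after the clients in `D` have got shared servers and those in `E` have
got private servers. -/
structure RoundState (Y : Finset M) (κ : M → ℕ) (ord : M → List M) (i : ℕ) (s₀ : Subsets M)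
    (D E : List M) (s : Subsets M) : Prop where
  valid : s.Valid Y
  picks : ∃ sh pr, Picks κ ord i s₀.avail D E sh pr s
  shared_eq : ∀ j, j ≠ i → s.shared j = s₀.shared j
  priv_eq : ∀ j, j ≠ i → s.priv j = s₀.priv j

variable {s₀ : Subsets M}

theorem RoundState.meets_takeShared (h : RoundState Y κ ord i s₀ D D s) (hi : 1 ≤ i)
    (hord : ServerOrder X Y ord) (hN : Separated κ ord Xbar i (net i))
    (hD : ∀ z ∈ D, z ∈ net i) (hxD : x ∉ D) (hA : Plenty κ ord k net i s₀.avail) (hx : x ∈ X)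
    (hκ : κ x ≤ Y.card) (hik : i ≤ k) (hxN : x ∈ net i) {n : ℕ} (hY : Y.card ≤ n) :
    Meets (takeShared Y κ ord i x s) (2 * (n + 2) ^ 2)
      (RoundState Y κ ord i s₀ (D ++ [x]) D) := by
  classical
  obtain ⟨sh, pr, hp⟩ := h.picks
  by_cases hxi : 2 * i ≤ κ x
  -- Nothing has been taken from the neighbourhood of `x` in this round before its turn. Hence the
  -- pick is the farthest even among the servers available at the start of the round, as `sh_last`
  -- demands.
  · have hav : ∀ y ∈ nbhd ord x (κ x - (i - 1)), y ∈ s₀.avail → y ∈ s.avail := by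
      intro y hy hyA
      by_contra hys
      have := hp.owner_eq hi hN hD hD hxN (by omega) hy hyA hys
      tauto
    have hle := hA.le_card hord hx hκ hik hxN (by omega)
    obtain ⟨z, hz⟩ := Finset.card_pos.1
      (show 0 < (nbhd ord x (κ x - (i - 1)) ∩ s₀.avail).card by omega)
    rw [Finset.mem_inter] at hz
    refine (MMC.meets_takeShared (hord.nodup x hx) hxi hz.1 (hav z hz.1 hz.2) hY).weaken le_rfl ?_
    rintro _ ⟨y, rfl, hy, hys, hlast⟩
    exact ⟨h.valid.moveShared hys, ⟨_, _, hp.moveShared hxD hxi hy fun m hm z hz hzA =>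
      hlast m hm z hz (hav z hz hzA)⟩,
      fun j hj => (Function.update_of_ne hj _ _).trans (h.shared_eq j hj), h.priv_eq⟩
  · rw [takeShared, if_neg hxi]
    exact Meets.steps (by ring_nf; omega) ⟨h.valid, ⟨sh, pr, hp.skipShared (by omega)⟩,
      h.shared_eq, h.priv_eq⟩

theorem RoundState.meets_takePrivate (h : RoundState Y κ ord i s₀ (D ++ [x]) D s) (hi : 1 ≤ i)
    (hord : ServerOrder X Y ord) (hN : Separated κ ord Xbar i (net i))
    (hD : ∀ z ∈ D, z ∈ net i) (hxD : x ∉ D) (hA : Plenty κ ord k net i s₀.avail) (hx : x ∈ X)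
    (hκ : κ x ≤ Y.card) (hik : i ≤ k) (hxN : x ∈ net i) {n : ℕ} (hY : Y.card ≤ n) :
    Meets (takePrivate Y κ ord i x s) (2 * (n + 2) ^ 2)
      (RoundState Y κ ord i s₀ (D ++ [x]) (D ++ [x])) := by
  classical
  obtain ⟨sh, pr, hp⟩ := h.picks
  by_cases hxi : 2 * i - 1 ≤ κ x
  · obtain ⟨z, hz, hzs⟩ := hp.exists_private hi hord hN hD hxD hA hx hκ hik hxN hxi
    refine (MMC.meets_takePrivate hxi hz hzs hY).weaken le_rfl ?_
    rintro _ ⟨y, rfl, hy, hys⟩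
    exact ⟨h.valid.movePriv hys, ⟨_, _, hp.movePriv hxD hxi hy⟩, h.shared_eq,
      fun j hj => (Function.update_of_ne hj _ _).trans (h.priv_eq j hj)⟩
  · rw [takePrivate, if_neg hxi]
    exact Meets.steps (by ring_nf; omega) ⟨h.valid, ⟨sh, pr, hp.skipPriv (by omega)⟩,
      h.shared_eq, h.priv_eq⟩

/-- What is known about the server subsets that are computed. -/
structure Partitioned (X Y : Finset M) (κ : M → ℕ) (k : ℕ) (ord : M → List M) (Xbar : Finset M)
    (net : ℕ → Finset M) (s : Subsets M) : Prop where
  order : ServerOrder X Y ord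
  threatFree : ThreatFree X κ ord Xbar
  hierarchy : IsHierarchy κ ord Xbar k net
  valid : s.Valid Y
  served : Served κ ord net ((k + 1) / 2 + 1) s

theorem meets_computeServerSubsets (X Y : Finset M) (κ : M → ℕ) (k : ℕ)
    (hκ : ∀ x ∈ X, κ x ≤ Y.card) {n : ℕ} (hX : X.card ≤ n) (hY : Y.card ≤ n) (hk : k ≤ n) :
    Meets (computeServerSubsets X Y κ k) (200 * (n + 2) ^ 5) fun s =>
      ∃ ord Xbar net, Partitioned X Y κ k ord Xbar net s := by
  classical
  refine (meets_serverOrders X Y hX hY).bind (T₂ := 180 * (n + 2) ^ 5) (fun ord hord => ?_)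
    (by ring_nf; omega)
  refine (meets_filterClients X Y κ ord hX hY).bind (T₂ := 130 * (n + 2) ^ 5)
    (fun Xbar hT => ?_) (by ring_nf; omega)
  have hXbar : Xbar.card ≤ n := (Finset.card_le_card hT.subset).trans hX
  refine (meets_netHierarchy Xbar Y κ ord k hXbar hY hk).bind (T₂ := 100 * (n + 2) ^ 5)
    (fun net hnet => ?_) (by ring_nf; omega)
  refine Meets.steps_bind (T₂ := 90 * (n + 2) ^ 5) ?_
    ((Nat.add_le_add_right (Nat.add_le_add_right hY 1) _).trans (by ring_nf; omega))
  refine (meets_loop_range' (T := 10 * (n + 2) ^ 3)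
    (fun i s => s.Valid Y ∧ Plenty κ ord k net i s.avail ∧ Served κ ord net i s)
    ⟨?_, ?_, ?_⟩ ?_).weaken ?_ fun s hs => ⟨ord, Xbar, net, hord, hT, hnet, hs.1, hs.2.2⟩
  · exact ⟨subset_rfl, by simp, by simp, by simp, by simp, by simp, by simp, by simp⟩
  · intro j hj hjk x hx hxκ S hS hSd
    have hxX : x ∈ X := hT.subset ((hnet.isNet j hj hjk).subset hx)
    have : S = ∅ := disjoint_self.1
      (Finset.disjoint_of_subset_right (hS.trans (hord.nbhd_subset hxX _)) hSd)
    simp [this]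
  · intro j hj hj1
    omega
  · rintro i s₀ hi hil ⟨hV, hA, hS⟩
    have hik : i ≤ k := by omega
    have hsep := (hnet.isNet i hi hik).toSeparated
    have hc : (net i).card ≤ n := (Finset.card_le_card hsep.subset).trans hXbar
    refine (meets_enum (net i)).bind (T₂ := 8 * (n + 2) ^ 3) (fun L hL => ?_)
      (by ring_nf; omega)
    refine (meets_loop_of_le (N := n) (T := 4 * (n + 2) ^ 2)
      (fun D s => RoundState Y κ ord i s₀ D D s) (by omega) ?_ ?_).weaken (by ring_nf; omega) ?_
    · exact ⟨hV, ⟨id, id, subset_rfl, fun y hy hys => absurd hy hys, by simp, by simp, by simp,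
        by simp, by simp⟩, fun _ _ => rfl, fun _ _ => rfl⟩
    · intro D x E s hD h
      have hmem : ∀ z ∈ D ++ x :: E, z ∈ net i := fun z hz => (hL.2.2 z).1 (hD ▸ hz)
      have hDN : ∀ z ∈ D, z ∈ net i := fun z hz => hmem z (by simp [hz])
      have hxN : x ∈ net i := hmem x (by simp)
      have hnd := hL.1
      rw [hD] at hnd
      have hxD : x ∉ D := fun hxD => (List.nodup_append.1 hnd).2.2 x hxD x (by simp) rfl
      have hxX : x ∈ X := hT.subset (hsep.subset hxN)
      refine (h.meets_takeShared hi hord hsep hDN hxD hA hxX (hκ x hxX) hik hxN hY).bind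
        (fun s' h' => h'.meets_takePrivate hi hord hsep hDN hxD hA hxX (hκ x hxX) hik hxN hY)
        (by ring_nf; omega)
    · intro s h
      obtain ⟨sh, pr, hp⟩ := h.picks
      refine ⟨h.valid, hp.plenty_succ hi hord hκ hT hnet hL.2.2 hA, fun j hj hji x hx => ?_⟩
      rcases Nat.lt_or_ge j i with hji' | hji'
      · rw [h.shared_eq j hji'.ne, h.priv_eq j hji'.ne]
        exact hS j hj hji' x hx
      · obtain rfl : j = i := by omega
        have hxL := (hL.2.2 x).2 hx
        exact ⟨fun hxj => ⟨sh x, hp.sh_mem x hxL hxj, hp.sh_nbhd x hxL hxj⟩, fun hxj =>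
          ⟨pr x, hp.pr_mem x hxL hxj, nbhd_mono x (by omega) (hp.pr_nbhd x hxL hxj)⟩⟩
  · have : (k + 1) / 2 * (10 * (n + 2) ^ 3 + 1) ≤ n * (10 * (n + 2) ^ 3 + 1) :=
      Nat.mul_le_mul_right _ (by omega)
    refine (Nat.add_le_add_right this 1).trans ?_
    ring_nf
    omega

end Partition

/-! # Comparison with an arbitrary cover -/

section Links

variable {M : Type u} {X Xbar : Finset M} {κ : M → ℕ} {ord : M → List M}

/-- The clients `a` and `b` are equal or have a common server in their neighbourhoods of level
`i`. -/
def Linked (κ : M → ℕ) (ord : M → List M) (i : ℕ) (a b : M) : Prop :=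
  a = b ∨ ∃ y, y ∈ nbhd ord a (κ a - (i - 1)) ∧ y ∈ nbhd ord b (κ b - (i - 1))

theorem Near.linked {i : ℕ} {a b : M} (h : Near κ ord i a b) : Linked κ ord i a b :=
  h.imp id fun h => Finset.not_disjoint_iff.1 h.2.2

/-- An edge at level `i` forces `κ b ≥ 2 * i - 1`. So `κ b < t ≤ 2 * i` leaves only `κ b = 2 * i -
1`, and then `κ b / 2 = i - 1`: the edge is precisely a threat of `b` to `a`. -/
theorem ThreatFree.le_of_near (hT : ThreatFree X κ ord Xbar) {i t : ℕ} (hi : 1 ≤ i)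
    (ht : t ≤ 2 * i) {a b : M} (ha : a ∈ Xbar) (hb : b ∈ Xbar)
    (h : Near κ ord i a b) (hta : t ≤ κ a) : t ≤ κ b := by
  rcases h with rfl | h
  · exact hta
  · by_contra hlt
    have h1 := h.2.1
    refine hT.not_threatens a ha b hb ⟨by omega, ?_⟩
    rw [show κ b / 2 = i - 1 by omega]
    exact h.2.2

end Links

/-! ### Disjoint families of balls and the charging argument. -/

section Comparison

variable {M : Type u} [MetricSpace M]

/-- Greedy selection of balls that share no client, by decreasing radius. -/
theorem exists_greedy_balls (X : Finset M) (r : M → ℝ≥0) (S : Finset M) : ∃ A ⊆ S,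
    (∀ x ∈ X, ∀ c ∈ A, ∀ c' ∈ A, dist x c ≤ r c → dist x c' ≤ r c' → c = c') ∧
    ∀ y ∈ S, ∀ x ∈ X, dist x y ≤ r y → ∃ c ∈ A, r y ≤ r c ∧ dist x c ≤ 3 * r c := by
  classical
  induction S using Finset.strongInduction with
  | H S ih =>
  rcases S.eq_empty_or_nonempty with rfl | hne
  · exact ⟨∅, by simp⟩
  obtain ⟨y₀, hy₀, hmax⟩ := Finset.exists_max_image S r hne
  obtain ⟨A, hAS, hA, hcov⟩ := ih (S.filter fun y => y ≠ y₀ ∧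
      ∀ x ∈ X, dist x y ≤ r y → ¬ dist x y₀ ≤ r y₀)
    (Finset.filter_ssubset.2 ⟨y₀, hy₀, by simp⟩)
  have hA' : ∀ c ∈ A, c ∈ S ∧ c ≠ y₀ ∧ ∀ x ∈ X, dist x c ≤ r c → ¬ dist x y₀ ≤ r y₀ :=
    fun c hc => Finset.mem_filter.1 (hAS hc)
  refine ⟨insert y₀ A, Finset.insert_subset hy₀ fun c hc => (hA' c hc).1,
    fun x hx c hc c' hc' h h' => ?_, fun y hy x hx hxy => ?_⟩
  · rcases Finset.mem_insert.1 hc with hc0 | hcA <;>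
      rcases Finset.mem_insert.1 hc' with hc0' | hcA'
    · rw [hc0, hc0']
    · exact absurd (hc0 ▸ h) ((hA' c' hcA').2.2 x hx h')
    · exact absurd (hc0' ▸ h') ((hA' c hcA).2.2 x hx h)
    · exact hA x hx c hcA c' hcA' h h'
  · by_cases hyA : y ≠ y₀ ∧ ∀ x ∈ X, dist x y ≤ r y → ¬ dist x y₀ ≤ r y₀
    · obtain ⟨c, hc, h⟩ := hcov y (Finset.mem_filter.2 ⟨hy, hyA⟩) x hx hxy
      exact ⟨c, Finset.mem_insert_of_mem hc, h⟩
    -- A ball that was removed is the largest ball `y₀` itself or shares a client `w` with it, so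
    -- `x` is within `r y + r y + r y₀ ≤ 3 * r y₀` of `y₀`.
    · refine ⟨y₀, Finset.mem_insert_self _ _, hmax y hy, ?_⟩
      have hle : (r y : ℝ) ≤ r y₀ := hmax y hy
      by_cases hyy : y = y₀
      · subst hyy
        have := (r y).coe_nonneg
        linarith
      · push Not at hyA
        obtain ⟨w, -, hwy, hwy₀⟩ := hyA hyy
        have := dist_triangle4 x y w y₀
        rw [dist_comm y w] at this
        linarith

/-- A cover contains disjoint families of balls such that the tripled balls of the `j`-th family
cover every client `x` of demand larger than `j` by a ball that is at least as large as
the distance of `x` to its nearest `κ x - j` servers. -/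
theorem exists_families {X Y : Finset M} {κ : M → ℕ} {ord : M → List M}
    (hord : ServerOrder X Y ord) (hκ : ∀ x ∈ X, κ x ≤ Y.card) {r : M → ℝ≥0}
    (hr : IsCover X Y κ r) : ∃ A : ℕ → Finset M, (∀ j, A j ⊆ Y) ∧
      (∀ i j, i ≠ j → Disjoint (A i) (A j)) ∧
      ∀ j, ∀ x ∈ X, j < κ x → ∃ c ∈ A j, dist x c ≤ 3 * r c ∧
        ∀ y ∈ nbhd ord x (κ x - j), dist x y ≤ r c := by
  classical
  choose g hgS hg1 hg2 using exists_greedy_balls X r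
  -- `R j` is what remains after `j` greedy families have been removed.
  let R : ℕ → Finset M := fun j => Nat.rec Y (fun _ S => S \ g S) j
  have hR0 : R 0 = Y := rfl
  have hRs : ∀ j, R (j + 1) = R j \ g (R j) := fun _ => rfl
  have hanti : Antitone R := antitone_nat_of_succ_le fun j => by
    rw [hRs]; exact Finset.sdiff_subset
  -- Each family has at most one ball containing `x`, so a client loses at most one covering ball
  -- per family.
  have hcard : ∀ j, ∀ x ∈ X, κ x ≤ ((R j).filter fun y => dist x y ≤ r y).card + j := by
    intro j x hx
    induction j with
    | zero => exact hr x hx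
    | succ j ih =>
      have h1 : ((g (R j)).filter fun y => dist x y ≤ r y).card ≤ 1 :=
        Finset.card_le_one.2 fun c hc c' hc' => by
          rw [Finset.mem_filter] at hc hc'
          exact hg1 _ x hx c hc.1 c' hc'.1 hc.2 hc'.2
      have h2 : (R j).filter (fun y => dist x y ≤ r y) ⊆
          (R (j + 1)).filter (fun y => dist x y ≤ r y) ∪
            (g (R j)).filter fun y => dist x y ≤ r y := fun y hy => by
        rw [Finset.mem_filter] at hy
        by_cases hyg : y ∈ g (R j)
        · exact Finset.mem_union_right _ (Finset.mem_filter.2 ⟨hyg, hy.2⟩)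
        · refine Finset.mem_union_left _ (Finset.mem_filter.2 ⟨?_, hy.2⟩)
          rw [hRs]
          exact Finset.mem_sdiff.2 ⟨hy.1, hyg⟩
      have h3 := (Finset.card_le_card h2).trans (Finset.card_union_le _ _)
      omega
  have hlt : ∀ i j, i < j → Disjoint (g (R i)) (g (R j)) := fun i j hij => by
    refine Finset.disjoint_of_subset_right ((hgS _).trans (hanti (Nat.succ_le_of_lt hij))) ?_
    rw [Nat.succ_eq_add_one, hRs]
    exact Finset.disjoint_sdiff
  refine ⟨fun j => g (R j), fun j => (hgS _).trans (hanti (Nat.zero_le j)),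
    fun i j hij => ?_, fun j x hx hj => ?_⟩
  · rcases lt_or_gt_of_ne hij with h | h
    · exact hlt i j h
    · exact (hlt j i h).symm
  · have hm : κ x - j ≤ ((R j).filter fun y => dist x y ≤ r y).card := by
      have := hcard j x hx
      omega
    have hN := hord.card_nbhd hx (j := κ x - j) ((Nat.sub_le _ _).trans (hκ x hx))
    -- At least `κ x - j` remaining balls contain `x`. Their centres either are exactly the `κ x -
    -- j` nearest servers, and the farthest of them is taken, or include a server beyond these.
    obtain ⟨y, hyR, hxy, hy⟩ : ∃ y ∈ R j, dist x y ≤ r y ∧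
        ∀ z ∈ nbhd ord x (κ x - j), dist x z ≤ dist x y := by
      by_cases hsub : (R j).filter (fun y => dist x y ≤ r y) ⊆ nbhd ord x (κ x - j)
      · have heq := Finset.eq_of_subset_of_card_le hsub (by omega)
        obtain ⟨y, hy, hmax⟩ := Finset.exists_max_image (nbhd ord x (κ x - j)) (fun y => dist x y)
          (Finset.card_pos.1 (by omega))
        have hy' := hy
        rw [← heq, Finset.mem_filter] at hy'
        exact ⟨y, hy'.1, hy'.2, hmax⟩
      · obtain ⟨y, hy, hyN⟩ := Finset.not_subset.1 hsub
        rw [Finset.mem_filter] at hy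
        exact ⟨y, hy.1, hy.2, fun z hz => hord.dist_le hx hz (hanti (Nat.zero_le j) hy.1) hyN⟩
    obtain ⟨c, hc, hyc, hxc⟩ := hg2 (R j) y hyR x hx hxy
    exact ⟨c, hc, hxc, fun z hz => (hy z hz).trans (hxy.trans hyc)⟩

/-- If every client in `Z` is close to a ball of `A` and to a server in `S`, relative to the radius
of the ball, then there is a cheap cover of `Z` by `S`. -/
theorem exists_cheap_cover {α : ℝ} (hα : 1 ≤ α) {Z S A : Finset M} {r : M → ℝ≥0}
    (h : ∀ x ∈ Z, ∃ c ∈ A, ∃ y ∈ S, dist x c ≤ 9 * r c ∧ dist x y ≤ 7 * r c) :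
    ∃ q, IsCover Z S (fun _ => 1) q ∧ cost α S q ≤ 25 ^ α * cost α A r := by
  classical
  -- Each useful ball `c` gets one server `f c`, fixed through a single witness client `w`. Any
  -- other client of the ball reaches it through `c` and `w`, which gives 9 + 9 + 7 = 25. For
  -- useless balls the value `c` is a dummy.
  have h' : ∀ c, ∃ y, (∃ x ∈ Z, dist x c ≤ 9 * r c ∧ ∃ y ∈ S, dist x y ≤ 7 * r c) →
      y ∈ S ∧ ∃ x, dist x c ≤ 9 * r c ∧ dist x y ≤ 7 * r c := fun c => by
    by_cases hc : ∃ x ∈ Z, dist x c ≤ 9 * r c ∧ ∃ y ∈ S, dist x y ≤ 7 * r c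
    · obtain ⟨x, -, hxc, y, hy, hxy⟩ := hc
      exact ⟨y, fun _ => ⟨hy, x, hxc, hxy⟩⟩
    · exact ⟨c, fun h => absurd h hc⟩
  choose f hf using h'
  set B := A.filter fun c => ∃ x ∈ Z, dist x c ≤ 9 * r c ∧ ∃ y ∈ S, dist x y ≤ 7 * r c with hB
  refine ⟨fun y => (B.filter fun c => f c = y).sup fun c => 25 * r c, fun x hx => ?_, ?_⟩
  · obtain ⟨c, hc, y, hy, hxc, hxy⟩ := h x hx
    have hcB : c ∈ B := Finset.mem_filter.2 ⟨hc, x, hx, hxc, y, hy, hxy⟩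
    obtain ⟨hfS, w, hwc, hwf⟩ := hf c (Finset.mem_filter.1 hcB).2
    refine Finset.card_pos.2 ⟨f c, Finset.mem_filter.2 ⟨hfS, ?_⟩⟩
    have h1 : 25 * r c ≤ (B.filter fun c' => f c' = f c).sup fun c => 25 * r c :=
      Finset.le_sup (f := fun c => 25 * r c) (Finset.mem_filter.2 ⟨hcB, rfl⟩)
    have h2 : dist x (f c) ≤ 25 * r c := by
      have := dist_triangle4 x c w (f c)
      rw [dist_comm c w] at this
      linarith
    exact h2.trans (by exact_mod_cast h1)
  · refine (cost_sup_le hα (fun c hc => (hf c (Finset.mem_filter.1 hc).2).1) _).trans ?_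
    rw [cost, Finset.mul_sum]
    refine (Finset.sum_le_sum_of_subset (Finset.filter_subset _ _)).trans
      (Finset.sum_le_sum fun c _ => ?_)
    rw [NNReal.mul_rpow]

variable {X Y : Finset M} {κ : M → ℕ} {k : ℕ} {ord : M → List M} {Xbar : Finset M}
  {net : ℕ → Finset M} {s : Subsets M}

theorem Linked.dist_le {i : ℕ} {a b : M} (h : Linked κ ord i a b) {ρ : ℝ≥0}
    (ha : ∀ y ∈ nbhd ord a (κ a - (i - 1)), dist a y ≤ ρ)
    (hb : ∀ y ∈ nbhd ord b (κ b - (i - 1)), dist b y ≤ ρ) : dist a b ≤ 2 * ρ := by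
  rcases h with rfl | ⟨y, hya, hyb⟩
  · simp
  · have := dist_triangle_right a b y
    linarith [ha y hya, hb y hyb]

/-- A filtered client threatens a kept one of larger demand; since `κ x / 2 ≥ i - 1`, the threat is
a common server at level `i`. Two hops then lead into the net, and threat-freeness keeps the demand
at least `t` along them. -/
theorem Partitioned.exists_path (h : Partitioned X Y κ k ord Xbar net s) {i t : ℕ} (hi : 1 ≤ i)
    (hik : i ≤ k) (ht : 2 * i - 1 ≤ t) (ht' : t ≤ 2 * i) {x : M} (hx : x ∈ X) (htx : t ≤ κ x) :
    ∃ a ∈ X, ∃ b ∈ X, ∃ c ∈ net i, c ∈ X ∧ t ≤ κ a ∧ t ≤ κ b ∧ t ≤ κ c ∧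
      Linked κ ord i x a ∧ Linked κ ord i a b ∧ Linked κ ord i b c := by
  obtain ⟨a, ha, hta, hxa⟩ : ∃ a ∈ Xbar, t ≤ κ a ∧ Linked κ ord i x a := by
    by_cases hxb : x ∈ Xbar
    · exact ⟨x, hxb, htx, .inl rfl⟩
    · obtain ⟨a, ha, hxa⟩ := h.threatFree.threatens x hx hxb
      obtain ⟨y, hya, hyx⟩ := Finset.not_disjoint_iff.1 hxa.2
      exact ⟨a, ha, htx.trans hxa.1.le, .inr ⟨y, nbhd_mono x (by omega) hyx,
        nbhd_mono a (by omega) hya⟩⟩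
  have hnet := h.hierarchy.isNet i hi hik
  obtain ⟨c, hc, b, hb, hab, hbc⟩ := hnet.dominates a ha
  have htb := h.threatFree.le_of_near hi ht' ha hb hab hta
  have htc := h.threatFree.le_of_near hi ht' hb (hnet.subset hc) hbc htb
  exact ⟨a, h.threatFree.subset ha, b, h.threatFree.subset hb, c, hc,
    h.threatFree.subset (hnet.subset hc), hta, htb, htc, hxa, hab.linked, hbc.linked⟩

/-- The subsets of level `i` contain servers that are close to the clients. -/
theorem Partitioned.exists_close (h : Partitioned X Y κ k ord Xbar net s) {i t : ℕ} (hi : 1 ≤ i)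
    (hik : i ≤ k) (ht : 2 * i - 1 ≤ t) (ht' : t ≤ 2 * i) {S A : Finset M} {r : M → ℝ≥0}
    (hS : ∀ x ∈ net i, t ≤ κ x → ∃ y ∈ S, y ∈ nbhd ord x (κ x - (i - 1)))
    (hA : ∀ x ∈ X, i - 1 < κ x → ∃ c ∈ A, dist x c ≤ 3 * r c ∧
        ∀ y ∈ nbhd ord x (κ x - (i - 1)), dist x y ≤ r c) {x : M} (hx : x ∈ X) (htx : t ≤ κ x) :
    ∃ c ∈ A, ∃ y ∈ S, dist x c ≤ 9 * r c ∧ dist x y ≤ 7 * r c := by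
  obtain ⟨a, ha, b, hb, c, hcN, hc, hta, htb, htc, hxa, hab, hbc⟩ :=
    h.exists_path hi hik ht ht' hx htx
  obtain ⟨y, hyS, hy⟩ := hS c hcN htc
  obtain ⟨ex, hex, hdx, hnx⟩ := hA x hx (by omega)
  obtain ⟨ea, hea, hda, hna⟩ := hA a ha (by omega)
  obtain ⟨eb, heb, hdb, hnb⟩ := hA b hb (by omega)
  obtain ⟨ec, hec, hdc, hnc⟩ := hA c hc (by omega)
  -- `e` is the largest of the four balls. Each link then has length at most `2 * r e`, so `x` is
  -- within 6 radii of `a`, `b` and `c`. One more radius leads from `c` to its server, and three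
  -- more lead from the owner of `e` to the centre of `e`.
  have key : ∀ e ∈ A, r ex ≤ r e → r ea ≤ r e → r eb ≤ r e → r ec ≤ r e →
      dist x e ≤ dist x c + 3 * r e ∨ dist x e ≤ dist x a + 3 * r e ∨
        dist x e ≤ dist x b + 3 * r e ∨ dist x e ≤ 3 * r e →
      ∃ c ∈ A, ∃ y ∈ S, dist x c ≤ 9 * r c ∧ dist x y ≤ 7 * r c := by
    intro e he h1 h2 h3 h4 hd
    have hxa' := hxa.dist_le (fun y hy => (hnx y hy).trans h1) fun y hy => (hna y hy).trans h2
    have hab' := hab.dist_le (fun y hy => (hna y hy).trans h2) fun y hy => (hnb y hy).trans h3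
    have hbc' := hbc.dist_le (fun y hy => (hnb y hy).trans h3) fun y hy => (hnc y hy).trans h4
    have hcy : dist c y ≤ r e := (hnc y hy).trans h4
    have t1 := dist_triangle x a b
    have t2 := dist_triangle x b c
    have t3 := dist_triangle x c y
    have hnn := (r e).coe_nonneg
    refine ⟨e, he, y, hyS, ?_, by linarith⟩
    rcases hd with hd | hd | hd | hd <;> linarith
  have tc := dist_triangle x c ec
  have ta := dist_triangle x a ea
  have tb := dist_triangle x b eb
  rcases le_total (r ex) (r ea) with h1 | h1 <;> rcases le_total (r eb) (r ec) with h2 | h2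
  · rcases le_total (r ea) (r ec) with h3 | h3
    · exact key ec hec (h1.trans h3) h3 h2 le_rfl (.inl (by linarith))
    · exact key ea hea h1 le_rfl (h2.trans h3) h3 (.inr (.inl (by linarith)))
  · rcases le_total (r ea) (r eb) with h3 | h3
    · exact key eb heb (h1.trans h3) h3 le_rfl h2 (.inr (.inr (.inl (by linarith))))
    · exact key ea hea h1 le_rfl h3 (h2.trans h3) (.inr (.inl (by linarith)))
  · rcases le_total (r ex) (r ec) with h3 | h3
    · exact key ec hec h3 (h1.trans h3) h2 le_rfl (.inl (by linarith))
    · exact key ex hex le_rfl h1 (h2.trans h3) h3 (.inr (.inr (.inr hdx)))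
  · rcases le_total (r ex) (r eb) with h3 | h3
    · exact key eb heb h3 (h1.trans h3) le_rfl h2 (.inr (.inr (.inl (by linarith))))
    · exact key ex hex le_rfl h1 h3 (h2.trans h3) (.inr (.inr (.inr hdx)))

/-- For every level `i` there are `1`-covers by the `i`-th subsets of cost at most `b i`. -/
def HasCovers (α : ℝ) (X : Finset M) (κ : M → ℕ) (l : ℕ) (s : Subsets M) (b : ℕ → ℝ≥0) : Prop :=
  ∀ i, 1 ≤ i → i ≤ l →
    (∃ q, IsCover (X.filter fun x => 2 * i ≤ κ x) (s.shared i) (fun _ => 1) q ∧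
      cost α (s.shared i) q ≤ b i) ∧
    ∃ q, IsCover (X.filter fun x => 2 * i - 1 ≤ κ x) (s.priv i) (fun _ => 1) q ∧
      cost α (s.priv i) q ≤ b i

/-- Level `i` is charged to the family `A (i - 1)`, once for the shared and once for the private
subset. As the families are disjoint, the levels together cost no more than the whole cover, up to
`25 ^ α`. -/
theorem Partitioned.exists_hasCovers (h : Partitioned X Y κ k ord Xbar net s)
    (hκ : ∀ x ∈ X, κ x ≤ Y.card) {α : ℝ} (hα : 1 ≤ α) {r : M → ℝ≥0} (hr : IsCover X Y κ r) :
    ∃ b : ℕ → ℝ≥0, HasCovers α X κ ((k + 1) / 2) s b ∧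
      ∑ i ∈ Finset.range ((k + 1) / 2), b (i + 1) ≤ 25 ^ α * cost α Y r := by
  classical
  obtain ⟨A, hAY, hAd, hA⟩ := exists_families h.order hκ hr
  refine ⟨fun i => 25 ^ α * cost α (A (i - 1)) r, fun i hi hil => ⟨?_, ?_⟩, ?_⟩
  · refine exists_cheap_cover hα fun x hx => ?_
    rw [Finset.mem_filter] at hx
    exact h.exists_close hi (by omega) (by omega) le_rfl
      (fun z hz hzi => (h.served i hi (by omega) z hz).1 hzi) (hA (i - 1)) hx.1 hx.2
  · refine exists_cheap_cover hα fun x hx => ?_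
    rw [Finset.mem_filter] at hx
    exact h.exists_close hi (by omega) le_rfl (by omega)
      (fun z hz hzi => (h.served i hi (by omega) z hz).2 hzi) (hA (i - 1)) hx.1 hx.2
  · simp only [Nat.add_sub_cancel]
    rw [← Finset.mul_sum]
    gcongr
    simp only [cost]
    rw [← Finset.sum_biUnion fun i _ j _ hij => hAd i j hij]
    refine Finset.sum_le_sum_of_subset fun y hy => ?_
    obtain ⟨j, -, hy⟩ := Finset.mem_biUnion.1 hy
    exact hAY j hy

end Comparison

/-! # The algorithm -/

/-- This bounds the time of black-box calls on subsets of the clients and servers by the time bound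
at the full size. -/
theorem eval_monotone (p : Polynomial ℕ) : Monotone fun n => p.eval n := fun a b hab => by
  simp only [Polynomial.eval_eq_sum, Polynomial.sum]
  gcongr

section Algorithm

variable {M : Type u} [MetricSpace M] {X Y : Finset M} {κ : M → ℕ} {α : ℝ}

theorem IsCover.nonempty {Z S : Finset M} {q : M → ℝ≥0} (h : IsCover Z S (fun _ => 1) q)
    (hZ : Z.Nonempty) : S.Nonempty := by
  obtain ⟨x, hx⟩ := hZ
  obtain ⟨y, hy⟩ := Finset.card_pos.1 (Nat.lt_of_lt_of_le Nat.zero_lt_one (h x hx))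
  exact ⟨y, (Finset.mem_filter.1 hy).1⟩

theorem IsCover.exists_mem {Z S : Finset M} {q : M → ℝ≥0} (h : IsCover Z S (fun _ => 1) q)
    {x : M} (hx : x ∈ Z) : ∃ y ∈ S, dist x y ≤ q y := by
  obtain ⟨y, hy⟩ := Finset.card_pos.1 (Nat.lt_of_lt_of_le Nat.zero_lt_one (h x hx))
  exact ⟨y, Finset.mem_filter.1 hy⟩

theorem IsCover.congr {Z S : Finset M} {m : M → ℕ} {q q' : M → ℝ≥0} (h : IsCover Z S m q)
    (hq : ∀ y ∈ S, q' y = q y) : IsCover Z S m q' := fun x hx => by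
  classical
  refine (h x hx).trans (Finset.card_le_card fun y hy => ?_)
  rw [Finset.mem_filter] at *
  rwa [hq y hy.1]

theorem exists_isCover (hκ : ∀ x ∈ X, κ x ≤ Y.card) : ∃ r, IsCover X Y κ r := by
  classical
  refine ⟨fun y => ∑ x ∈ X, nndist x y, fun x hx => (hκ x hx).trans (le_of_eq ?_)⟩
  congr 1
  refine (Finset.filter_true_of_mem fun y _ => ?_).symm
  have : nndist x y ≤ ∑ x ∈ X, nndist x y :=
    Finset.single_le_sum (f := fun x => nndist x y) (fun _ _ => zero_le) hx
  exact_mod_cast this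

/-- A call of the black box for the clients of demand at least `j`. -/
theorem meets_coverDemand {Cover : CoverProcedure.{u}} {p : Polynomial ℕ}
    (hC : ∀ X' Y' : Finset M, (X'.Nonempty → Y'.Nonempty) →
      Meets (Cover M α X' Y') (p.eval (X'.card + Y'.card)) fun r =>
        IsCover X' Y' (fun _ => 1) r ∧
        ∀ r', IsCover X' Y' (fun _ => 1) r' → cost α Y' r ≤ 3 ^ α * cost α Y' r')
    {n : ℕ} (hn : X.card + Y.card ≤ n) {S : Finset M} (hS : S ⊆ Y) {j : ℕ}
    (hne : ∃ q, IsCover (X.filter fun x => j ≤ κ x) S (fun _ => 1) q) (r : M → ℝ≥0) :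
    Meets (coverDemand Cover α X κ j S r) (p.eval n + 6 * n + 2) fun r' =>
      IsCover (X.filter fun x => j ≤ κ x) S (fun _ => 1) r' ∧ (∀ y, y ∉ S → r' y = r y) ∧
      ∀ q, IsCover (X.filter fun x => j ≤ κ x) S (fun _ => 1) q →
        cost α Y r' ≤ cost α Y r + 3 ^ α * cost α S q := by
  classical
  have hSc := Finset.card_le_card hS
  refine Meets.select_bind (T₂ := p.eval n + n + 1) (fun Z hZ => ?_) (by omega)
  obtain rfl : Z = X.filter fun x => j ≤ κ x := by ext; simp [hZ]
  obtain ⟨q₀, hq₀⟩ := hne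
  refine (hC _ S hq₀.nonempty).bind (T₂ := n + 1) (fun q hq => Meets.steps (by omega) ?_) ?_
  · have hqS : ∀ y ∈ S, (if y ∈ S then q y else r y) = q y := fun y hy => if_pos hy
    refine ⟨hq.1.congr hqS, fun y hy => if_neg hy, fun q' hq' => ?_⟩
    refine le_trans ?_ (add_le_add_right (hq.2 q' hq') _)
    simp only [cost]
    rw [← Finset.sum_sdiff hS]
    refine add_le_add ?_ (le_of_eq (Finset.sum_congr rfl fun y hy => by rw [hqS y hy]))
    refine (le_of_eq (Finset.sum_congr rfl fun y hy => ?_)).trans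
      (Finset.sum_le_sum_of_subset Finset.sdiff_subset)
    rw [if_neg (Finset.mem_sdiff.1 hy).2]
  · have : p.eval ((X.filter fun x => j ≤ κ x).card + S.card) ≤ p.eval n :=
      eval_monotone p ((add_le_add (Finset.card_filter_le _ _) hSc).trans hn)
    omega

/-- Disjoint `1`-covers combine to a `κ`-cover. -/
theorem isCover_of_levels {F : Subsets M} (hF : F.Valid Y) {r : M → ℝ≥0}
    (h : ∀ i, 1 ≤ i → IsCover (X.filter fun x => 2 * i ≤ κ x) (F.shared i) (fun _ => 1) r ∧
      IsCover (X.filter fun x => 2 * i - 1 ≤ κ x) (F.priv i) (fun _ => 1) r) :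
    IsCover X Y κ r := by
  classical
  intro x hx
  have hs : ∀ i, ∃ y, 1 ≤ i → 2 * i ≤ κ x → y ∈ F.shared i ∧ dist x y ≤ r y := fun i => by
    by_cases hi : 1 ≤ i ∧ 2 * i ≤ κ x
    · obtain ⟨y, hy⟩ := (h i hi.1).1.exists_mem (Finset.mem_filter.2 ⟨hx, hi.2⟩)
      exact ⟨y, fun _ _ => hy⟩
    · exact ⟨x, fun h1 h2 => absurd ⟨h1, h2⟩ hi⟩
  have hp : ∀ i, ∃ y, 1 ≤ i → 2 * i - 1 ≤ κ x → y ∈ F.priv i ∧ dist x y ≤ r y := fun i => by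
    by_cases hi : 1 ≤ i ∧ 2 * i - 1 ≤ κ x
    · obtain ⟨y, hy⟩ := (h i hi.1).2.exists_mem (Finset.mem_filter.2 ⟨hx, hi.2⟩)
      exact ⟨y, fun _ _ => hy⟩
    · exact ⟨x, fun h1 h2 => absurd ⟨h1, h2⟩ hi⟩
  choose sh hsh using hs
  choose pr hpr using hp
  -- The first `⌊κ x / 2⌋` indices go to the shared subsets of levels `a + 1`, the remaining `⌈κ x /
  -- 2⌉` to the private subsets starting again at level 1.
  have key : ∀ a ∈ Finset.range (κ x),
      (a < κ x / 2 ∧ sh (a + 1) ∈ F.shared (a + 1) ∧ dist x (sh (a + 1)) ≤ r (sh (a + 1))) ∨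
      (¬ a < κ x / 2 ∧ pr (a - κ x / 2 + 1) ∈ F.priv (a - κ x / 2 + 1) ∧
        dist x (pr (a - κ x / 2 + 1)) ≤ r (pr (a - κ x / 2 + 1))) := by
    intro a ha
    rw [Finset.mem_range] at ha
    by_cases hlt : a < κ x / 2
    · exact .inl ⟨hlt, hsh (a + 1) (by omega) (by omega)⟩
    · exact .inr ⟨hlt, hpr (a - κ x / 2 + 1) (by omega) (by omega)⟩
  conv_lhs => rw [← Finset.card_range (κ x)]
  refine Finset.card_le_card_of_injOn
    (fun a => if a < κ x / 2 then sh (a + 1) else pr (a - κ x / 2 + 1))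
    (fun a ha => ?_) fun a ha b hb hab => ?_
  · simp only [Finset.coe_filter, Set.mem_ofPred_eq]
    rcases key a ha with ⟨h0, h1, h2⟩ | ⟨h0, h1, h2⟩
    · simp only [if_pos h0]
      exact ⟨hF.shared_subset _ h1, h2⟩
    · simp only [if_neg h0]
      exact ⟨hF.priv_subset _ h1, h2⟩
  · rcases key a ha with ⟨h0, h1, -⟩ | ⟨h0, h1, -⟩ <;>
      rcases key b hb with ⟨h0', h1', -⟩ | ⟨h0', h1', -⟩ <;>
      simp only [h0, h0', if_true, if_false] at hab <;> rw [hab] at h1 <;> by_contra hne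
    · exact Finset.disjoint_left.1 (hF.shared_shared (a + 1) (b + 1) (by omega)) h1 h1'
    · exact Finset.disjoint_left.1 (hF.shared_priv _ _) h1 h1'
    · exact Finset.disjoint_left.1 (hF.shared_priv _ _) h1' h1
    · exact Finset.disjoint_left.1
        (hF.priv_priv (a - κ x / 2 + 1) (b - κ x / 2 + 1) (by omega)) h1 h1'

/-- The radii after the rounds `1, …, i - 1` of calls of the black box. -/
structure CoverState (α : ℝ) (X Y : Finset M) (κ : M → ℕ) (l : ℕ) (F : Subsets M) (i : ℕ)
    (r : M → ℝ≥0) : Prop where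
  shared : ∀ j, 1 ≤ j → j < i →
    IsCover (X.filter fun x => 2 * j ≤ κ x) (F.shared j) (fun _ => 1) r
  priv : ∀ j, 1 ≤ j → j < i →
    IsCover (X.filter fun x => 2 * j - 1 ≤ κ x) (F.priv j) (fun _ => 1) r
  cost_le : ∀ b, HasCovers α X κ l F b →
    cost α Y r ≤ 2 * 3 ^ α * ∑ j ∈ Finset.range (i - 1), b (j + 1)

/-- The run of the algorithm does not depend on the cover it is compared with, so the cost invariant
is kept for all level bounds `b` at once and instantiated only at the end. -/
theorem meets_nonUniformCover {Cover : CoverProcedure.{u}} {p : Polynomial ℕ}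
    (hα : 1 ≤ α)
    (hC : ∀ X' Y' : Finset M, (X'.Nonempty → Y'.Nonempty) →
      Meets (Cover M α X' Y') (p.eval (X'.card + Y'.card)) fun r =>
        IsCover X' Y' (fun _ => 1) r ∧
        ∀ r', IsCover X' Y' (fun _ => 1) r' → cost α Y' r ≤ 3 ^ α * cost α Y' r')
    (hκ : ∀ x ∈ X, κ x ≤ Y.card) {n : ℕ} (hn : X.card + Y.card ≤ n) :
    Meets (nonUniformCover Cover α X Y κ)
      (300 * (n + 2) ^ 5 + n * (2 * p.eval n + 12 * n + 5)) fun out =>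
      IsCover X Y κ out.radius ∧
      (∀ r', IsCover X Y κ r' → cost α Y out.radius ≤ 2 * 75 ^ α * cost α Y r') ∧
      (∃ avail, (Subsets.mk avail out.shared out.priv).Valid Y) ∧
      ∀ i, 1 ≤ i →
        IsCover (X.filter fun x => 2 * i ≤ κ x) (out.shared i) (fun _ => 1) out.radius ∧
        IsCover (X.filter fun x => 2 * i - 1 ≤ κ x) (out.priv i) (fun _ => 1) out.radius := by
  classical
  have hX : X.card ≤ n := by omega
  have hY : Y.card ≤ n := by omega
  have hpos : 0 < α := by linarith
  set k := X.sup κ with hk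
  have hkn : k ≤ n := Finset.sup_le fun x hx => (hκ x hx).trans hY
  have hxk : ∀ x ∈ X, κ x ≤ k := fun x hx => Finset.le_sup hx
  set l := (k + 1) / 2 with hl
  set P := p.eval n with hP
  refine Meets.steps_bind (T₂ := 290 * (n + 2) ^ 5 + n * (2 * P + 12 * n + 5)) ?_
    (by ring_nf; omega)
  refine (meets_computeServerSubsets X Y κ k hκ hX hY hkn).bind
    (T₂ := 60 * (n + 2) ^ 5 + n * (2 * P + 12 * n + 5)) (fun F hF => ?_) (by ring_nf; omega)
  obtain ⟨ord, Xbar, net, hF⟩ := hF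
  refine Meets.steps_bind (T₂ := 2 + n * (2 * P + 12 * n + 5)) ?_ (by ring_nf; omega)
  -- Some `κ`-cover is needed beforehand: the level covers derived from it show that every call of
  -- the black box is solvable.
  obtain ⟨r₀, hr₀⟩ := exists_isCover hκ
  obtain ⟨b₀, hb₀, -⟩ := hF.exists_hasCovers hκ hα hr₀
  refine (meets_loop_range' (T := 2 * P + 12 * n + 4) (CoverState α X Y κ l F)
    ⟨by omega, by omega, fun b _ => ?_⟩ ?_).bind (T₂ := 1)
    (fun r hr => Meets.steps le_rfl ?_) ?_
  · simp [cost, NNReal.zero_rpow hpos.ne']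
  · intro i r hi hil h
    have hsub := hF.valid.shared_subset i
    have hne_sh : ∀ j, j ≠ i → Disjoint (F.shared j) (F.shared i) :=
      fun j hj => hF.valid.shared_shared j i hj
    have hfirst : Meets (if Even k ∨ i < l then coverDemand Cover α X κ (2 * i) (F.shared i) r
        else steps 1 r) (P + 6 * n + 2) fun r' =>
          (∀ j, 1 ≤ j → j < i + 1 →
            IsCover (X.filter fun x => 2 * j ≤ κ x) (F.shared j) (fun _ => 1) r') ∧
          (∀ j, 1 ≤ j → j < i →
            IsCover (X.filter fun x => 2 * j - 1 ≤ κ x) (F.priv j) (fun _ => 1) r') ∧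
          ∀ b, HasCovers α X κ l F b →
            cost α Y r' ≤ 2 * 3 ^ α * ∑ j ∈ Finset.range (i - 1), b (j + 1) + 3 ^ α * b i := by
      split_ifs with hc
      · refine (meets_coverDemand hC hn hsub ((hb₀ i hi hil).1.imp fun _ h => h.1) r).weaken
          le_rfl fun r' hr' => ⟨fun j hj hji => ?_, fun j hj hji => ?_, fun b hb => ?_⟩
        · by_cases hji' : j = i
          · subst hji'
            exact hr'.1
          · exact (h.shared j hj (by omega)).congr fun y hy =>
              hr'.2.1 y (Finset.disjoint_left.1 (hne_sh j hji') hy)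
        · exact (h.priv j hj hji).congr fun y hy =>
            hr'.2.1 y (Finset.disjoint_right.1 (hF.valid.shared_priv i j) hy)
        · obtain ⟨q, hq, hqc⟩ := (hb i hi hil).1
          refine (hr'.2.2 q hq).trans (add_le_add (h.cost_le b hb) ?_)
          gcongr
      · refine Meets.steps (by omega) ⟨fun j hj hji => ?_, h.priv, fun b hb =>
          (h.cost_le b hb).trans le_self_add⟩
        -- The call is skipped only when `k` is odd and `i = l`. Then `2 * i = k + 1` exceeds every
        -- demand and there is no client to cover.
        by_cases hji' : j = i
        · intro x hx
          rw [Finset.mem_filter] at hx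
          have := hxk x hx.1
          push Not at hc
          have hodd := Nat.not_even_iff.1 hc.1
          omega
        · exact h.shared j hj (by omega)
    refine hfirst.bind (T₂ := P + 6 * n + 2) (fun r' h' => ?_) (by omega)
    refine (meets_coverDemand hC hn (hF.valid.priv_subset i)
      ((hb₀ i hi hil).2.imp fun _ h => h.1) r').weaken le_rfl
      fun r'' hr'' => ⟨fun j hj hji => ?_, fun j hj hji => ?_, fun b hb => ?_⟩
    · exact (h'.1 j hj hji).congr fun y hy =>
        hr''.2.1 y (Finset.disjoint_left.1 (hF.valid.shared_priv j i) hy)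
    · by_cases hji' : j = i
      · subst hji'
        exact hr''.1
      · exact (h'.2.1 j hj (by omega)).congr fun y hy =>
          hr''.2.1 y (Finset.disjoint_left.1 (hF.valid.priv_priv j i hji') hy)
    · obtain ⟨q, hq, hqc⟩ := (hb i hi hil).2
      have h1 := hr''.2.2 q hq
      have h2 := h'.2.2 b hb
      have h3 : (3 : ℝ≥0) ^ α * cost α (F.priv i) q ≤ 3 ^ α * b i := by gcongr
      obtain ⟨m, rfl⟩ : ∃ m, i = m + 1 := ⟨i - 1, by omega⟩
      rw [Nat.add_sub_cancel, Finset.sum_range_succ]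
      rw [Nat.add_sub_cancel] at h2
      calc _ ≤ _ := h1
        _ ≤ _ := add_le_add h2 h3
        _ = _ := by ring
  · have hcov : ∀ i, 1 ≤ i →
        IsCover (X.filter fun x => 2 * i ≤ κ x) (F.shared i) (fun _ => 1) r ∧
        IsCover (X.filter fun x => 2 * i - 1 ≤ κ x) (F.priv i) (fun _ => 1) r := by
      intro i hi
      rcases Nat.lt_or_ge i (l + 1) with hil | hil
      · exact ⟨hr.shared i hi hil, hr.priv i hi hil⟩
      · constructor <;> intro x hx <;> rw [Finset.mem_filter] at hx <;>
          have := hxk x hx.1 <;> omega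
    refine ⟨isCover_of_levels hF.valid hcov, fun r' hr' => ?_, ⟨F.avail, hF.valid⟩, hcov⟩
    obtain ⟨b, hb, hbc⟩ := hF.exists_hasCovers hκ hα hr'
    calc cost α Y r ≤ 2 * 3 ^ α * ∑ j ∈ Finset.range l, b (j + 1) := by
          simpa using hr.cost_le b hb
      _ ≤ 2 * 3 ^ α * (25 ^ α * cost α Y r') := by gcongr
      _ = 2 * 75 ^ α * cost α Y r' := by
          rw [show (75 : ℝ≥0) = 3 * 25 by norm_num, NNReal.mul_rpow]
          ring
  · have : l * (2 * P + 12 * n + 4 + 1) ≤ n * (2 * P + 12 * n + 5) :=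
      Nat.mul_le_mul (by omega) le_rfl
    exact (Nat.add_le_add_right (Nat.add_le_add_right this 1) 1).trans (by omega)

end Algorithm

end MMC

theorem mainTheorem2 :
    -- a concrete procedure that can play the role of the black box
    MMC.IsPolyTimeCover.{u} (fun _ _ α X' Y' => MMC.primalDualCover α X' Y') ∧
    -- the algorithm, with an arbitrary procedure in the role of the black box
    ∀ Cover : MMC.CoverProcedure.{u}, MMC.IsPolyTimeCover Cover →
      ∃ p : Polynomial ℕ, ∀ (M : Type u) [MetricSpace M] (α : ℝ), 1 ≤ α →
        ∀ (X Y : Finset M) (κ : M → ℕ), (∀ x ∈ X, κ x ≤ Y.card) →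
          (∃ out t, (MMC.nonUniformCover Cover α X Y κ).run out t) ∧
          ∀ out t, (MMC.nonUniformCover Cover α X Y κ).run out t →
            -- polynomial running time
            t ≤ p.eval (X.card + Y.card) ∧
            -- a `κ`-cover within the claimed factor of every `κ`-cover
            MMC.IsCover X Y κ out.radius ∧
            (∀ r', MMC.IsCover X Y κ r' →
              MMC.cost α Y out.radius ≤ 2 * 144 ^ α * MMC.cost α Y r') ∧
            -- the server subsets are pairwise disjoint
            (∀ i, out.shared i ⊆ Y ∧ out.priv i ⊆ Y) ∧
            Pairwise (fun i j => Disjoint (out.shared i) (out.shared j)) ∧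
            Pairwise (fun i j => Disjoint (out.priv i) (out.priv j)) ∧
            (∀ i j, Disjoint (out.shared i) (out.priv j)) ∧
            -- and each of them `1`-covers the clients of sufficiently large demand
            ∀ i, 1 ≤ i →
              MMC.IsCover (X.filter fun x => 2 * i ≤ κ x) (out.shared i) (fun _ => 1)
                out.radius ∧
              MMC.IsCover (X.filter fun x => 2 * i - 1 ≤ κ x) (out.priv i) (fun _ => 1)
                out.radius := by
  refine ⟨MMC.isPolyTimeCover_primalDualCover, fun Cover ⟨p, hp⟩ => ?_⟩
  refine ⟨300 * (Polynomial.X + 2) ^ 5 +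
    Polynomial.X * (2 * p + 12 * Polynomial.X + 5), fun M _ α hα X Y κ hκ => ?_⟩
  have h := MMC.meets_nonUniformCover (p := p) hα (hp M α hα) hκ le_rfl
  refine ⟨h.1, fun out t ht => ?_⟩
  obtain ⟨h1, h2, h3, ⟨avail, hV⟩, h4⟩ := h.2 out t ht
  refine ⟨by simpa using h1, h2, fun r' hr' => (h3 r' hr').trans ?_,
    fun i => ⟨hV.shared_subset i, hV.priv_subset i⟩, fun i j hij => hV.shared_shared i j hij,
    fun i j hij => hV.priv_priv i j hij, hV.shared_priv, h4⟩
  have hpos : 0 ≤ α := by linarith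
  -- The factor obtained is `2 * 75 ^ α`, so what remains is `75 ≤ 144`.
  gcongr
  norm_num
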